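/- A two-dimensional configuration is a formal power series $c=\sum_{v\in\mathbb Z^2}c_vX^v$ with complex coefficients; it is integral if all $c_v$ are integers, and finitary if it has only finitely many distinct coefficients. Laurent polynomials in two variables act on configurations by formal multiplication, and $\mathrm{Ann}(c)=\{f\in\mathbb C[x,y] : fc=0\}$, an ideal of $\mathbb C[x,y]$. A line polynomial is a polynomial whose support has at least two points and lies on a single line; its direction is the one-dimensional subspace of $\mathbb Q^2$ parallel to that line. A configuration is periodic if $c_{v+u}=c_v$ for all $v$, for some non-zero $u\in\mathbb Z^2$ (a period of $c$); it is doubly periodic if it has two linearly independent periods, and one-periodic if it is periodic but not doubly periodic. Theorem (Strong decomposition theorem). Let $c$ be a two-dimensional finitary integral configuration with a non-trivial annihilator, i.e. $fc=0$ for some non-zero Laurent polynomial $f$ over $\mathbb C$. Then $\mathrm{Ann}(c)$ can be written as $$\mathrm{Ann}(c)=\varphi_1\cdots\varphi_m H ,\qquad (*)$$ where $m\ge 0$, the $\varphi_i\in\mathbb C[x,y]$ are line polynomials in pairwise distinct directions, and $H$ is an ideal of $\mathbb C[x,y]$ that is an intersection of finitely many maximal ideals (the empty intersection $H=\mathbb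 C[x,y]$ being allowed). For every such expression $(*)$, with $\varphi=\varphi_1\cdots\varphi_m$, there exist two-dimensional configurations $c_\varphi,c_H,c_1,\dots,c_m$ (with complex coefficients) such that $$c=c_\varphi+c_H,\qquad c_\varphi=c_1+\cdots+c_m,$$ $$\mathrm{Ann}(c_\varphi)=\langle\varphi\rangle,\qquad \mathrm{Ann}(c_H)=H,\qquad \mathrm{Ann}(c_i)=\langle\varphi_i\rangle\quad(1\le i\le m).$$ Each $c_i$ is one-periodic, with a non-zero period in the direction of $\varphi_i$, and $c_H$ is doubly periodic. Moreover $c_\varphi$ and $c_H$ are uniquely determined: if $c=a+b$ with $\mathrm{Ann}(a)=\langle\varphi\rangle$ and $\mathrm{Ann}(b)=H$, then $a=c_\varphi$ and $b=c_H$. -/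

import Mathlib

noncomputable section

namespace MultidimConfig

/-- A `d`-dimensional configuration: a formal power series `∑ c_v X^v` over `v ∈ ℤ^d` with complex
coefficients, given by its coefficients. -/
abbrev Config (d : ℕ) : Type := (Fin d → ℤ) → ℂ

/-- Laurent polynomials in `d` variables over `ℂ`. -/
abbrev Laurent (d : ℕ) : Type := AddMonoidAlgebra ℂ (Fin d → ℤ)

/-- The exponent vector of a monomial, viewed in `ℤ^d`. -/
def expCast (d : ℕ) : (Fin d →₀ ℕ) →+ (Fin d → ℤ) where
  toFun u i := (u i : ℤ)
  map_zero' := by ext i; simp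
  map_add' u v := by ext i; simp

/-- The inclusion `ℂ[X] ⊆ ℂ[X^{±1}]`. -/
def toLaurent (d : ℕ) : MvPolynomial (Fin d) ℂ →+* Laurent d :=
  AddMonoidAlgebra.mapDomainRingHom ℂ (expCast d)

/-- The formal product of a Laurent polynomial `f = ∑ a_u X^u` and a configuration:
`(f c)_v = ∑_u a_u c_{v - u}`. -/
def act {d : ℕ} (f : Laurent d) (c : Config d) : Config d :=
  fun v => ∑ u ∈ f.coeff.support, f.coeff u * c (v - u)

/-- Translation of configurations, as an action of the group `ℤ^d` by linear maps. -/
def shiftHom (d : ℕ) : Multiplicative (Fin d → ℤ) →* Module.End ℂ (Config d) where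
  toFun u :=
    { toFun := fun c v => c (v - u.toAdd)
      map_add' := fun _ _ => rfl
      map_smul' := fun _ _ => rfl }
  map_one' := by ext c v; simp
  map_mul' u w := by
    ext c v
    simp [sub_sub]

theorem act_eq_lift {d : ℕ} (f : Laurent d) (c : Config d) :
    act f c = AddMonoidAlgebra.lift ℂ (Module.End ℂ (Config d)) (Fin d → ℤ) (shiftHom d) f c := by
  funext v
  rw [AddMonoidAlgebra.lift_apply]
  simp [act, Finsupp.sum, shiftHom, LinearMap.sum_apply, Finset.sum_apply]

/-- `Ann(c)`: the ideal of all polynomials `f ∈ ℂ[X]` with `f c = 0`. -/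
def Ann {d : ℕ} (c : Config d) : Ideal (MvPolynomial (Fin d) ℂ) where
  carrier := {f | act (toLaurent d f) c = 0}
  zero_mem' := by simp [act_eq_lift]
  add_mem' {f g} hf hg := by
    simp only [Set.mem_ofPred_eq, act_eq_lift] at hf hg ⊢
    simp [hf, hg]
  smul_mem' f g hg := by
    simp only [Set.mem_ofPred_eq, act_eq_lift] at hg ⊢
    simp [hg]

/-- All coefficients are integers. -/
def IsIntegral {d : ℕ} (c : Config d) : Prop := ∀ v, ∃ n : ℤ, c v = n

/-- There are only finitely many distinct coefficients. -/
def IsFinitary {d : ℕ} (c : Config d) : Prop := (Set.range c).Finite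

/-- `c` is `u`-periodic. -/
def HasPeriod {d : ℕ} (c : Config d) (u : Fin d → ℤ) : Prop := ∀ v, c (v + u) = c v

/-- `c` is periodic. -/
def IsPeriodic {d : ℕ} (c : Config d) : Prop := ∃ u, u ≠ 0 ∧ HasPeriod c u

/-- `c` is periodic in two linearly independent vectors. -/
def IsDoublyPeriodic (c : Config 2) : Prop :=
  ∃ u w : Fin 2 → ℤ, LinearIndependent ℤ ![u, w] ∧ HasPeriod c u ∧ HasPeriod c w

/-- `c` is periodic but not doubly periodic. -/
def IsOnePeriodic (c : Config 2) : Prop := IsPeriodic c ∧ ¬ IsDoublyPeriodic c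

/-- An integer vector as a rational vector. -/
def toRat {d : ℕ} (v : Fin d → ℤ) : Fin d → ℚ := fun i => (v i : ℚ)

/-- The support of a Laurent polynomial, as a set of points of `ℚ^d`. -/
def suppRat {d : ℕ} (f : Laurent d) : Set (Fin d → ℚ) := toRat '' (f.coeff.support : Set (Fin d → ℤ))

/-- `f` is a line Laurent polynomial: its support has at least two points, and all the points of
the support lie on a single line. -/
def IsLine {d : ℕ} (f : Laurent d) : Prop := (suppRat f).Nontrivial ∧ Collinear ℚ (suppRat f)

/-- The direction of a line Laurent polynomial `f`: the subspace of `ℚ^d` spanned by the differences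
of points of the support. For a line Laurent polynomial this is the line `⟨v⟩`, where
`f = X^{v'} (a_n X^{n v} + ⋯ + a_1 X^v + a_0)`. -/
def direction {d : ℕ} (f : Laurent d) : Submodule ℚ (Fin d → ℚ) := vectorSpan ℚ (suppRat f)

/-- `c` is one-periodic in the direction `W`: it is one-periodic and has a non-zero period in `W`. -/
def IsOnePeriodicIn (c : Config 2) (W : Submodule ℚ (Fin 2 → ℚ)) : Prop :=
  IsOnePeriodic c ∧ ∃ u, u ≠ 0 ∧ toRat u ∈ W ∧ HasPeriod c u

/-- `Ann(c) = φ_1 ⋯ φ_m H`, where the `φ_i` are line polynomials in pairwise distinct directions and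
`H` is the intersection of a finite (possibly empty) set of maximal ideals. -/
structure IsAnnDecomposition (c : Config 2) (m : ℕ) (φ : Fin m → MvPolynomial (Fin 2) ℂ)
    (H : Ideal (MvPolynomial (Fin 2) ℂ)) : Prop where
  line : ∀ i, IsLine (toLaurent 2 (φ i))
  direction_ne : ∀ i j, i ≠ j →
    direction (toLaurent 2 (φ i)) ≠ direction (toLaurent 2 (φ j))
  inter_maximal : ∃ S : Finset (Ideal (MvPolynomial (Fin 2) ℂ)),
    (∀ M ∈ S, M.IsMaximal) ∧ H = S.inf id
  ann_eq : Ann c = Ideal.span {∏ i, φ i} * H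

end MultidimConfig

end

/-!
A finitary integral configuration `c` with a non-trivial annihilator has an annihilator `F` with
integral coefficients. Since `F(X)^p ≡ F(X^p)` modulo `p` and `c` takes finitely many values, also
`F(X^k) c = 0` for all `k` without small prime factors (`act_dilate_prime_mul`). Interpolating
between these annihilators shows that a product of binomials `X^u - 1` annihilates `c`
(`exists_prod_binom`). On bounded configurations `(X^u - 1)²` and `X^u - 1` annihilate the same
elements, so the vectors `u` can be taken in pairwise distinct directions
(`exists_pairwise_det_ne_zero`).

Existence of the factorization. Take out the greatest common divisor: `Ann c = φ J`, where the
elements of `J` have no common factor. The Gauss lemma gives non-zero elements of `J` in `x` alone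
and in `y` alone. As `J = Ann (φ c)` and `φ c` is finitary, the pigeonhole principle makes `φ c`
doubly periodic, so `J` contains some `x^M - 1` and `y^N - 1` and is an intersection of finitely
many maximal ideals. Moreover `φ` divides the product of binomials. The width of the support in a
fixed direction is additive under products, so divisors of polynomials supported on a line are
supported on parallel lines (`IsAlong.of_dvd`), and `φ` is a product of line polynomials in distinct
directions.

Decomposition. Given `Ann c = φ H`, the ideals `(φ)` and `H` are comaximal: a common zero would be
a singular point of some `X^u - 1` on the torus (`notMem_of_Ann_eq`). Writing `1 = a φ + e` with
`e ∈ H`, the components are `e c` and `a φ c`, and they are unique (`Ann_components`). The component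
`e c` is a linear functional on `R ⧸ (φ)`, with `R` the Laurent polynomial ring. The factors `φ_i`
are relatively prime, so `R ⧸ (φ)` embeds into the product of the `R ⧸ (φ_i)`, and an extension of
the functional to this product yields the summands `c_i` (`exists_eq_sum_of_prod_mem_Ann`).
-/

namespace MultidimConfig

open Finset

/-! ### The action of Laurent polynomials -/

section Action

variable {d : ℕ} (f g : Laurent d) (b c : Config d)

lemma act_add_left : act (f + g) c = act f c + act g c := by simp [act_eq_lift]

lemma act_sub_left : act (f - g) c = act f c - act g c := by simp [act_eq_lift]

lemma act_mul : act (f * g) c = act f (act g c) := by simp [act_eq_lift]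

@[simp] lemma act_one : act (1 : Laurent d) c = c := by simp [act_eq_lift]

@[simp] lemma act_zero_left : act (0 : Laurent d) c = 0 := by simp [act_eq_lift]

@[simp] lemma act_zero_right : act f (0 : Config d) = 0 := by simp [act_eq_lift]

lemma act_add_right : act f (b + c) = act f b + act f c := by simp [act_eq_lift]

lemma act_sum_left {ι : Type*} (s : Finset ι) (F : ι → Laurent d) :
    act (∑ i ∈ s, F i) c = ∑ i ∈ s, act (F i) c := by simp [act_eq_lift]

lemma act_sum_right {ι : Type*} (s : Finset ι) (F : ι → Config d) :
    act f (∑ i ∈ s, F i) = ∑ i ∈ s, act f (F i) := by simp [act_eq_lift]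

lemma act_smul_left (a : ℂ) : act (a • f) c = a • act f c := by simp [act_eq_lift]

lemma act_single (u : Fin d → ℤ) (a : ℂ) (v : Fin d → ℤ) :
    act (AddMonoidAlgebra.single u a : Laurent d) c v = a * c (v - u) := by
  simp [act_eq_lift, shiftHom]

variable {f g c} in
lemma act_eq_zero_of_dvd (h : f ∣ g) (hf : act f c = 0) : act g c = 0 := by
  obtain ⟨q, rfl⟩ := h
  rw [mul_comm, act_mul, hf, act_zero_right]

lemma mem_Ann {f : MvPolynomial (Fin d) ℂ} : f ∈ Ann c ↔ act (toLaurent d f) c = 0 := Iff.rfl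

lemma mem_Ann_act {f g : MvPolynomial (Fin d) ℂ} :
    f ∈ Ann (act (toLaurent d g) c) ↔ f * g ∈ Ann c := by
  rw [mem_Ann, mem_Ann, map_mul, act_mul]

lemma isUnit_single (u : Fin d → ℤ) {a : ℂ} (ha : a ≠ 0) :
    IsUnit (AddMonoidAlgebra.single u a : Laurent d) := by
  refine IsUnit.of_mul_eq_one (AddMonoidAlgebra.single (-u) a⁻¹) ?_
  rw [AddMonoidAlgebra.single_mul_single, add_neg_cancel, mul_inv_cancel₀ ha]
  rfl

variable {f c} in
lemma act_isUnit_mul (hg : IsUnit g) : act (g * f) c = 0 ↔ act f c = 0 := by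
  refine ⟨fun h => ?_, act_eq_zero_of_dvd (Dvd.intro_left g rfl)⟩
  obtain ⟨w, rfl⟩ := hg
  have := act_mul (↑w⁻¹ : Laurent d) (↑w * f) c
  simpa [h, ← mul_assoc] using this

lemma toLaurent_monomial (s : Fin d →₀ ℕ) (a : ℂ) :
    toLaurent d (MvPolynomial.monomial s a) = AddMonoidAlgebra.single (expCast d s) a := by
  exact AddMonoidAlgebra.mapDomain_single ..

lemma expCast_injective : Function.Injective (expCast d) := by
  intro s t h
  ext i
  have := congrFun h i
  simpa [expCast] using this

lemma toLaurent_injective : Function.Injective (toLaurent d) :=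
  AddMonoidAlgebra.mapDomain_injective expCast_injective

lemma isUnit_toLaurent_monomial (s : Fin d →₀ ℕ) {a : ℂ} (ha : a ≠ 0) :
    IsUnit (toLaurent d (MvPolynomial.monomial s a)) := by
  rw [toLaurent_monomial]
  exact isUnit_single _ ha

/-- Annihilator ideals are saturated with respect to the variables, since these act invertibly. -/
lemma X_mul_mem_Ann {i : Fin d} {f : MvPolynomial (Fin d) ℂ} :
    MvPolynomial.X i * f ∈ Ann c ↔ f ∈ Ann c := by
  rw [mem_Ann, map_mul, mem_Ann]
  exact act_isUnit_mul _ (isUnit_toLaurent_monomial _ one_ne_zero)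

lemma Ann_ne_top_iff : Ann c ≠ ⊤ ↔ c ≠ 0 := by
  rw [Ne, Ideal.eq_top_iff_one, mem_Ann, map_one, act_one]

lemma toLaurent_support (f : MvPolynomial (Fin d) ℂ) :
    ((toLaurent d f).coeff.support : Set (Fin d → ℤ)) = expCast d '' (f.support : Set _) := by
  classical
  have : (toLaurent d f).coeff.support = f.support.image (expCast d) :=
    Finsupp.mapDomain_support_of_injective expCast_injective _
  rw [this, Finset.coe_image]

/-- Every Laurent polynomial is a polynomial up to a monomial factor. -/
lemma exists_toLaurent_eq_mul (f : Laurent d) :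
    ∃ (s : Fin d →₀ ℕ) (p : MvPolynomial (Fin d) ℂ),
      toLaurent d p = f * toLaurent d (MvPolynomial.monomial s 1) := by
  induction f using AddMonoidAlgebra.induction_linear with
  | zero => exact ⟨0, 0, by simp⟩
  | add f g hf hg =>
    obtain ⟨s, p, hp⟩ := hf
    obtain ⟨t, q, hq⟩ := hg
    refine ⟨s + t, p * MvPolynomial.monomial t 1 + q * MvPolynomial.monomial s 1, ?_⟩
    have h : (MvPolynomial.monomial (s + t) (1 : ℂ)) =
      MvPolynomial.monomial s 1 * MvPolynomial.monomial t 1 := by simp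
    rw [h]
    simp only [map_add, map_mul, hp, hq]
    ring
  | single u a =>
    refine ⟨Finsupp.equivFunOnFinite.symm fun i => (-u i).toNat,
      MvPolynomial.monomial (Finsupp.equivFunOnFinite.symm fun i => (u i).toNat) a, ?_⟩
    rw [toLaurent_monomial, toLaurent_monomial, AddMonoidAlgebra.single_mul_single, mul_one]
    congr 1
    ext i
    simp [expCast]
    omega

variable {c} in
lemma IsFinitary.act (hc : IsFinitary c) : IsFinitary (act f c) := by
  induction f using AddMonoidAlgebra.induction_linear with
  | zero =>
    rw [act_zero_left]
    exact (Set.finite_singleton (0 : ℂ)).subset Set.range_const_subset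
  | add f g hf hg =>
    rw [act_add_left]
    refine (hf.add hg).subset ?_
    rintro _ ⟨v, rfl⟩
    exact Set.add_mem_add ⟨v, rfl⟩ ⟨v, rfl⟩
  | single u a =>
    refine (hc.image (a * ·)).subset ?_
    rintro _ ⟨v, rfl⟩
    exact ⟨_, ⟨v - u, rfl⟩, (act_single ..).symm⟩

variable {c} in
lemma IsFinitary.exists_bound (hc : IsFinitary c) : ∃ B, ∀ v, ‖c v‖ ≤ B := by
  obtain ⟨B, hB⟩ := hc.isBounded.exists_norm_le
  exact ⟨B, fun v => hB _ ⟨v, rfl⟩⟩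

end Action

/-! ### Annihilators that are products of binomials -/

section Binomial

/-- The determinant of two vectors of `ℤ²`; it vanishes exactly when they are parallel. -/
def det (u w : Fin 2 → ℤ) : ℤ := u 0 * w 1 - u 1 * w 0

/-- The Laurent binomial `X^u - 1`, whose annihilated configurations are the `u`-periodic ones. -/
noncomputable def binom {d : ℕ} (u : Fin d → ℤ) : Laurent d := AddMonoidAlgebra.single u 1 - 1

variable {d : ℕ}

lemma act_binom (u : Fin d → ℤ) (c : Config d) (v : Fin d → ℤ) :
    act (binom u) c v = c (v - u) - c v := by
  rw [binom, act_sub_left, act_one, Pi.sub_apply, act_single, one_mul]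

lemma act_binom_eq_zero_iff {u : Fin d → ℤ} {c : Config d} :
    act (binom u) c = 0 ↔ HasPeriod c u := by
  refine ⟨fun h v => ?_, fun h => ?_⟩
  · have := congrFun h (v + u)
    rw [act_binom, add_sub_cancel_right, Pi.zero_apply, sub_eq_zero] at this
    exact this.symm
  · funext v
    have := h (v - u)
    rw [sub_add_cancel] at this
    rw [act_binom, this, sub_self, Pi.zero_apply]

lemma binom_dvd_zsmul (u : Fin d → ℤ) (k : ℤ) : binom u ∣ binom (k • u) := by
  have hnat : ∀ (u : Fin d → ℤ) (n : ℕ), binom u ∣ binom (n • u) := fun u n => by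
    have h : (AddMonoidAlgebra.single (n • u) 1 : Laurent d) =
        (AddMonoidAlgebra.single u 1) ^ n := by
      rw [AddMonoidAlgebra.single_pow, one_pow]
    rw [binom, binom, h]
    simpa using sub_dvd_pow_sub_pow (AddMonoidAlgebra.single u 1 : Laurent d) 1 n
  have hneg : ∀ u : Fin d → ℤ, binom u ∣ binom (-u) := fun u => by
    refine ⟨AddMonoidAlgebra.single (-u) (-1), ?_⟩
    rw [binom, binom, sub_mul, AddMonoidAlgebra.single_mul_single, add_neg_cancel, one_mul, one_mul,
      AddMonoidAlgebra.single_neg, AddMonoidAlgebra.single_neg, sub_neg_eq_add,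
      ← AddMonoidAlgebra.one_def]
    ring
  obtain ⟨n, rfl | rfl⟩ := k.eq_nat_or_neg
  · simpa using hnat u n
  · rw [neg_smul]
    exact (by simpa using hnat u n : binom u ∣ binom ((n : ℤ) • u)).trans (hneg _)

/-- On bounded configurations the square of a binomial annihilates no more than the binomial does:
otherwise the configuration would grow linearly along `u`. -/
lemma act_binom_eq_zero_of_sq {u : Fin d → ℤ} {b : Config d} {B : ℝ} (hB : ∀ v, ‖b v‖ ≤ B)
    (h : act (binom u) (act (binom u) b) = 0) : act (binom u) b = 0 := by
  rw [act_binom_eq_zero_iff] at h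
  funext v
  set e := act (binom u) b with he
  have hper : ∀ n : ℕ, e (v - n • u) = e v := fun n => by
    induction n with
    | zero => simp
    | succ n ih =>
      rw [← ih, ← h (v - (n + 1) • u)]
      congr 1
      rw [succ_nsmul]
      abel
  have hlin : ∀ n : ℕ, b (v - n • u) = b v + n * e v := fun n => by
    induction n with
    | zero => simp
    | succ n ih =>
      have := hper n
      rw [he, act_binom, ← he, ih] at this
      rw [succ_nsmul, ← sub_sub]
      push_cast
      linear_combination this
  have hle : ∀ n : ℕ, n * ‖e v‖ ≤ 2 * B := fun n => by
    have h1 : (n : ℂ) * e v = b (v - n • u) - b v := by rw [hlin n]; ring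
    have h2 : (n : ℝ) * ‖e v‖ = ‖b (v - n • u) - b v‖ := by
      rw [← h1, norm_mul, Complex.norm_natCast]
    rw [h2]
    linarith [norm_sub_le (b (v - n • u)) (b v), hB v, hB (v - n • u)]
  by_contra hne
  obtain ⟨n, hn⟩ := exists_nat_gt (2 * B / ‖e v‖)
  rw [div_lt_iff₀ (norm_pos_iff.2 hne)] at hn
  linarith [hle n]

lemma exists_common_multiple_of_det_eq_zero {u w : Fin 2 → ℤ} (hu : u ≠ 0) (hw : w ≠ 0)
    (h : det u w = 0) : ∃ (t : Fin 2 → ℤ) (k l : ℤ), t ≠ 0 ∧ t = k • u ∧ t = l • w := by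
  rw [det, sub_eq_zero] at h
  by_cases hu0 : u 0 = 0
  · have hu1 : u 1 ≠ 0 := fun h1 => hu (by ext i; fin_cases i <;> simp [hu0, h1])
    have hw0 : w 0 = 0 := by simpa [hu0, hu1] using h
    have hw1 : w 1 ≠ 0 := fun h1 => hw (by ext i; fin_cases i <;> simp [hw0, h1])
    refine ⟨w 1 • u, w 1, u 1, smul_ne_zero hw1 hu, rfl, ?_⟩
    ext i; fin_cases i
    · simp [hu0, hw0]
    · exact mul_comm _ _
  · have hw0 : w 0 ≠ 0 := fun h0 => by
      have : w 1 = 0 := by simpa [hu0, h0] using h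
      exact hw (by ext i; fin_cases i <;> simp [h0, this])
    refine ⟨w 0 • u, w 0, u 0, smul_ne_zero hw0 hu, rfl, ?_⟩
    ext i; fin_cases i
    · exact mul_comm _ _
    · simp only [Pi.smul_apply, smul_eq_mul, Fin.mk_one]
      linarith

/-- Binomials in parallel directions can be merged into one: they all divide a common binomial, and
powers of a binomial may be dropped by boundedness. -/
lemma exists_pairwise_det_ne_zero {c : Config 2} (hc : IsFinitary c) (n : ℕ) :
    ∀ L : List (Fin 2 → ℤ), L.length = n → (∀ u ∈ L, u ≠ 0) → act (L.map binom).prod c = 0 →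
    ∃ L' : List (Fin 2 → ℤ), (∀ u ∈ L', u ≠ 0) ∧ L'.Pairwise (fun u w => det u w ≠ 0) ∧
      act (L'.map binom).prod c = 0 := by
  induction n with
  | zero =>
    intro L hL h0 h
    rw [List.length_eq_zero_iff] at hL
    subst hL
    exact ⟨[], h0, List.Pairwise.nil, h⟩
  | succ n ih =>
    intro L hL h0 h
    by_cases hp : L.Pairwise (fun u w => det u w ≠ 0)
    · exact ⟨L, h0, hp, h⟩
    -- two parallel vectors can be brought to the front
    obtain ⟨u, w, L₁, hperm, hdet⟩ : ∃ u w L₁, L.Perm (u :: w :: L₁) ∧ det u w = 0 := by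
      clear h0 h hL
      induction L with
      | nil => exact absurd List.Pairwise.nil hp
      | cons a L ihL =>
        rw [List.pairwise_cons, not_and_or] at hp
        obtain hp | hp := hp
        · push Not at hp
          obtain ⟨w, hw, hd⟩ := hp
          exact ⟨a, w, L.erase w, (List.perm_cons_erase hw).cons a, hd⟩
        · obtain ⟨u, w, L₁, h1, h2⟩ := ihL hp
          refine ⟨u, w, a :: L₁, (h1.cons a).trans ?_, h2⟩
          exact (List.Perm.swap _ _ _).trans ((List.Perm.swap _ _ _).cons u)
    have hu := h0 u (hperm.symm.subset (by simp))
    have hw := h0 w (hperm.symm.subset (by simp))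
    obtain ⟨t, k, l, ht, hk, hl⟩ := exists_common_multiple_of_det_eq_zero hu hw hdet
    refine ih (t :: L₁) (by have := hperm.length_eq; simp at this ⊢; omega) ?_ ?_
    · intro x hx
      rcases List.mem_cons.1 hx with rfl | hx
      · exact ht
      · exact h0 x (hperm.symm.subset (by simp [hx]))
    · rw [(hperm.map binom).prod_eq] at h
      simp only [List.map_cons, List.prod_cons] at h ⊢
      obtain ⟨B, hB⟩ := (hc.act (L₁.map binom).prod).exists_bound
      rw [act_mul]
      refine act_binom_eq_zero_of_sq hB ?_
      rw [← act_mul, ← act_mul]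
      refine act_eq_zero_of_dvd ?_ h
      rw [← mul_assoc]
      exact mul_dvd_mul (mul_dvd_mul (hk ▸ binom_dvd_zsmul u k) (hl ▸ binom_dvd_zsmul w l)) dvd_rfl

/-- The Laurent polynomial `F(X^k)` with complex coefficients obtained from an integral `F`. -/
noncomputable def dilate (F : AddMonoidAlgebra ℤ (Fin d → ℤ)) (k : ℕ) : Laurent d :=
  ∑ v ∈ F.coeff.support, AddMonoidAlgebra.single (k • v) (F.coeff v : ℂ)

lemma act_dilate (F : AddMonoidAlgebra ℤ (Fin d → ℤ)) (k : ℕ) (c : Config d) (v : Fin d → ℤ) :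
    act (dilate F k) c v = ∑ u ∈ F.coeff.support, (F.coeff u : ℂ) * c (v - k • u) := by
  rw [dilate, act_sum_left, Finset.sum_apply]
  simp only [act_single]

/-- Taking `p`-th powers is a Frobenius modulo `p`: `F(X^k)^p ≡ F(X^(pk))`. -/
lemma exists_pow_prime_eq (p : ℕ) [hp : Fact p.Prime] {ι : Type*} (s : Finset ι) (a : ι → ℤ)
    (e : ι → Fin d → ℤ) : ∃ Q : AddMonoidAlgebra ℤ (Fin d → ℤ),
      (∑ i ∈ s, AddMonoidAlgebra.single (e i) (a i)) ^ p =
        (∑ i ∈ s, AddMonoidAlgebra.single (p • e i) (a i)) + p * Q := by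
  classical
  induction s using Finset.induction_on with
  | empty => exact ⟨0, by simp [hp.out.ne_zero]⟩
  | insert j s hj ih =>
    obtain ⟨Q, hQ⟩ := ih
    obtain ⟨r, hr⟩ := exists_add_pow_prime_eq hp.out (AddMonoidAlgebra.single (e j) (a j))
      (∑ i ∈ s, AddMonoidAlgebra.single (e i) (a i))
    have hfermat : (p : ℤ) ∣ a j ^ p - a j := by
      rw [← ZMod.intCast_eq_intCast_iff_dvd_sub]
      push_cast
      rw [ZMod.pow_card]
    obtain ⟨z, hz⟩ := hfermat
    have hsing : (AddMonoidAlgebra.single (e j) (a j) : AddMonoidAlgebra ℤ (Fin d → ℤ)) ^ p =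
        AddMonoidAlgebra.single (p • e j) (a j) + p * AddMonoidAlgebra.single (p • e j) z := by
      rw [AddMonoidAlgebra.single_pow, sub_eq_iff_eq_add.1 hz, add_comm,
        AddMonoidAlgebra.single_add, AddMonoidAlgebra.natCast_def,
        AddMonoidAlgebra.single_mul_single, zero_add]
    rw [Finset.sum_insert hj, Finset.sum_insert hj, hr, hQ, hsing]
    exact ⟨AddMonoidAlgebra.single (p • e j) z + Q + AddMonoidAlgebra.single (e j) (a j) *
      (∑ i ∈ s, AddMonoidAlgebra.single (e i) (a i)) * r, by ring⟩

/-- An integral Laurent polynomial maps integral configurations to integral ones. -/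
lemma IsIntegral.act_map {c : Config d} (hc : IsIntegral c) (Q : AddMonoidAlgebra ℤ (Fin d → ℤ)) :
    IsIntegral (act (AddMonoidAlgebra.mapRingHom (Fin d → ℤ) (Int.castRingHom ℂ) Q) c) := by
  intro v
  induction Q using AddMonoidAlgebra.induction_linear with
  | zero => exact ⟨0, by simp⟩
  | add f g hf hg =>
    obtain ⟨m, hm⟩ := hf
    obtain ⟨n, hn⟩ := hg
    exact ⟨m + n, by rw [map_add, act_add_left, Pi.add_apply, hm, hn]; push_cast; rfl⟩
  | single u a =>
    obtain ⟨n, hn⟩ := hc (v - u)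
    exact ⟨a * n, by rw [AddMonoidAlgebra.mapRingHom_single, act_single, hn]; simp⟩

/-- If `F(X^k)` annihilates an integral configuration, then so does `F(X^(pk))` for every prime `p`
exceeding all values that `F(X^(pk))` can produce: these values are divisible by `p`. -/
lemma act_dilate_prime_mul {c : Config d} (hint : IsIntegral c) {B : ℝ} (hB : ∀ v, ‖c v‖ ≤ B)
    (F : AddMonoidAlgebra ℤ (Fin d → ℤ)) {k p : ℕ} (hp : p.Prime)
    (hlt : (∑ u ∈ F.coeff.support, ‖(F.coeff u : ℂ)‖) * B < p) (h : act (dilate F k) c = 0) :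
    act (dilate F (p * k)) c = 0 := by
  have := Fact.mk hp
  obtain ⟨Q, hQ⟩ := exists_pow_prime_eq p F.coeff.support F.coeff (fun v => k • v)
  have hQ' := congrArg (AddMonoidAlgebra.mapRingHom (Fin d → ℤ) (Int.castRingHom ℂ)) hQ
  simp only [map_pow, map_add, map_mul, map_sum, map_natCast, AddMonoidAlgebra.mapRingHom_single,
    Int.coe_castRingHom, smul_smul] at hQ'
  change dilate F k ^ p = dilate F (p * k) + _ at hQ'
  have h0 : act (dilate F k ^ p) c = 0 := act_eq_zero_of_dvd (dvd_pow_self _ hp.ne_zero) h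
  rw [hQ', act_add_left, ← nsmul_eq_mul, ← Nat.cast_smul_eq_nsmul ℂ, act_smul_left] at h0
  funext v
  obtain ⟨n, hn⟩ := hint.act_map Q v
  have hv := congrFun h0 v
  rw [Pi.add_apply, Pi.smul_apply, hn, Pi.zero_apply, smul_eq_mul] at hv
  have hval : act (dilate F (p * k)) c v = ((-(p * n) : ℤ) : ℂ) := by
    push_cast
    linear_combination hv
  have hbound : ‖act (dilate F (p * k)) c v‖ < p := by
    refine lt_of_le_of_lt ?_ hlt
    rw [act_dilate, Finset.sum_mul]
    refine (norm_sum_le _ _).trans (Finset.sum_le_sum fun u _ => ?_)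
    rw [norm_mul]
    exact mul_le_mul_of_nonneg_left (hB _) (norm_nonneg _)
  rw [hval, Complex.norm_intCast] at hbound
  have hn0 : n = 0 := by
    by_contra hn0
    have h1 : (1 : ℝ) ≤ |(n : ℝ)| := by exact_mod_cast Int.one_le_abs hn0
    push_cast at hbound
    rw [abs_neg, abs_mul, Nat.abs_cast] at hbound
    nlinarith [(Nat.cast_nonneg p : (0 : ℝ) ≤ p)]
  rw [hval, hn0]
  simp

/-- `act_dilate_prime_mul` applies repeatedly, as all prime factors of `1 + i * N!` exceed `N`. -/
lemma act_dilate_one_add_mul_factorial {c : Config d} (hint : IsIntegral c) {B : ℝ}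
    (hB : ∀ v, ‖c v‖ ≤ B) (F : AddMonoidAlgebra ℤ (Fin d → ℤ)) {N : ℕ}
    (hN : (∑ u ∈ F.coeff.support, ‖(F.coeff u : ℂ)‖) * B < N) (h : act (dilate F 1) c = 0)
    (i : ℕ) : act (dilate F (1 + i * N.factorial)) c = 0 := by
  have key : ∀ k : ℕ, k.Coprime N.factorial → k ≠ 0 → act (dilate F k) c = 0 := by
    intro k
    induction k using induction_on_primes with
    | zero => exact fun _ h => absurd rfl h
    | one => exact fun _ _ => h
    | prime_mul p a hp ih =>
      intro hco hne
      rw [Nat.coprime_mul_iff_left] at hco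
      refine act_dilate_prime_mul hint hB F hp (hN.trans_le ?_)
        (ih hco.2 (right_ne_zero_of_mul hne))
      have : ¬ p ≤ N := fun hle =>
        (Nat.Prime.coprime_iff_not_dvd hp).1 hco.1 (hp.dvd_factorial.2 hle)
      exact_mod_cast (not_le.1 this).le
  exact key _ (by simp [Nat.coprime_add_mul_right_left]) (by omega)

/-- An annihilator of an integral configuration can be taken with integral coefficients: apply to
the coefficients a `ℚ`-linear functional on `ℂ` and clear denominators. -/
lemma exists_integral_annihilator {c : Config d} (hint : IsIntegral c) {f : Laurent d} (hf : f ≠ 0)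
    (h : act f c = 0) : ∃ F : AddMonoidAlgebra ℤ (Fin d → ℤ), F ≠ 0 ∧ act (dilate F 1) c = 0 := by
  classical
  choose n hn using hint
  obtain ⟨u₀, hu₀⟩ : ∃ u, f.coeff u ≠ 0 := by
    by_contra! hz
    exact hf (AddMonoidAlgebra.ext (Finsupp.ext hz))
  obtain ⟨ψ, hψ⟩ : ∃ ψ : Module.Dual ℚ ℂ, ψ (f.coeff u₀) ≠ 0 := by
    by_contra! hz
    exact hu₀ ((Module.forall_dual_apply_eq_zero_iff ℚ _).1 hz)
  obtain ⟨D, hD⟩ := IsLocalization.exist_integer_multiples_of_finset (nonZeroDivisors ℤ)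
    (f.coeff.support.image fun u => ψ (f.coeff u))
  have hD0 : ((D : ℤ) : ℚ) ≠ 0 := by exact_mod_cast nonZeroDivisors.coe_ne_zero D
  have hex : ∀ u, ∃ a : ℤ, (a : ℚ) = (D : ℤ) * ψ (f.coeff u) := fun u => by
    by_cases hu : f.coeff u = 0
    · exact ⟨0, by simp [hu]⟩
    · obtain ⟨a, ha⟩ := hD _ (Finset.mem_image_of_mem _ (Finsupp.mem_support_iff.2 hu))
      exact ⟨a, by rw [← zsmul_eq_mul]; exact ha⟩
  choose a ha using hex
  have hsupp : ∀ u, a u ≠ 0 → u ∈ f.coeff.support := fun u hu => by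
    rw [Finsupp.mem_support_iff]
    rintro h0
    have := ha u
    rw [h0, map_zero, mul_zero] at this
    exact hu (by exact_mod_cast this)
  refine ⟨AddMonoidAlgebra.ofCoeff (Finsupp.onFinset f.coeff.support a hsupp), fun h0 => ?_, ?_⟩
  · have h1 : a u₀ = 0 := DFunLike.congr_fun (congrArg AddMonoidAlgebra.coeff h0) u₀
    have := ha u₀
    rw [h1, Int.cast_zero] at this
    exact mul_ne_zero hD0 hψ this.symm
  · funext v
    have h1 : ∑ u ∈ f.coeff.support, f.coeff u * c (v - u) = 0 := congrFun h v
    have h2 : ∑ u ∈ f.coeff.support, ψ (f.coeff u) * n (v - u) = 0 := by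
      rw [← map_zero ψ, ← h1, map_sum]
      refine Finset.sum_congr rfl fun u _ => ?_
      rw [hn, mul_comm, mul_comm (f.coeff u), ← zsmul_eq_mul, ← zsmul_eq_mul, map_zsmul]
    have h3 : ∑ u ∈ f.coeff.support, a u * n (v - u) = 0 := by
      have : ((∑ u ∈ f.coeff.support, a u * n (v - u) : ℤ) : ℚ) = 0 := by
        push_cast
        simp only [ha, mul_assoc]
        rw [← Finset.mul_sum, h2, mul_zero]
      exact_mod_cast this
    rw [act_dilate]
    simp only [one_smul, hn, Pi.zero_apply]
    rw [Finset.sum_subset (s₂ := f.coeff.support)]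
    · exact_mod_cast h3
    · exact Finsupp.support_onFinset_subset
    · intro u _ hu
      rw [Finsupp.notMem_support_iff.1 hu]
      simp

/-- A finitary integral configuration with a non-trivial annihilator is annihilated by a product of
binomials `X^u - 1`. With `F = ∑ a_v X^v` and `K` such that all `F(X^(1+iK))` annihilate `c`, the
combination of these with the coefficients of `∏_{v ≠ v₀} (T - X^(Kv))` is, by interpolation, a
monomial times the product of the `X^(Kv₀) - X^(Kv)`. -/
lemma exists_prod_binom (c : Config d) (hfin : IsFinitary c) (hint : IsIntegral c)
    (hann : ∃ f : Laurent d, f ≠ 0 ∧ act f c = 0) :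
    ∃ L : List (Fin d → ℤ), (∀ u ∈ L, u ≠ 0) ∧ act (L.map binom).prod c = 0 := by
  classical
  obtain ⟨f, hf, hfc⟩ := hann
  obtain ⟨F, hF, h1⟩ := exists_integral_annihilator hint hf hfc
  obtain ⟨B, hB⟩ := hfin.exists_bound
  obtain ⟨N, hN⟩ := exists_nat_gt ((∑ u ∈ F.coeff.support, ‖(F.coeff u : ℂ)‖) * B)
  obtain ⟨v₀, hv₀⟩ : F.coeff.support.Nonempty := by
    rw [Finsupp.support_nonempty_iff]
    exact fun h0 => hF (AddMonoidAlgebra.ext h0)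
  set K := N.factorial with hK
  have hK0 : (K : ℤ) ≠ 0 := by exact_mod_cast N.factorial_ne_zero
  set s := F.coeff.support.erase v₀ with hs
  let E : (Fin d → ℤ) → Laurent d := fun v => AddMonoidAlgebra.single v 1
  have hEadd : ∀ v w, E (v + w) = E v * E w := fun v w => by
    simp [E, AddMonoidAlgebra.single_mul_single]
  have hEpow : ∀ (k : ℕ) v, E (k • v) = E v ^ k := fun k v => by
    simp [E, AddMonoidAlgebra.single_pow]
  -- the polynomial in `T` that vanishes at `X^(K v)` for all exponents `v ≠ v₀` of `F`
  let P : Polynomial (Laurent d) := ∏ v ∈ s, (Polynomial.X - Polynomial.C (E (K • v)))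
  have hdil : ∀ i : ℕ, dilate F (1 + i * K) =
      ∑ v ∈ F.coeff.support, (F.coeff v : ℂ) • (E v * E (K • v) ^ i) := fun i => by
    refine Finset.sum_congr rfl fun v _ => ?_
    have hexp : v + i • K • v = (1 + i * K) • v := by
      rw [add_smul, one_smul, smul_smul]
    rw [← hEpow, ← hEadd, hexp]
    simp [E]
  have hkey : ∑ i ∈ P.support, P.coeff i * dilate F (1 + i * K) =
      (F.coeff v₀ : ℂ) • (E v₀ * P.eval (E (K • v₀))) := by
    have hone : ∀ v ∈ F.coeff.support, v ≠ v₀ → P.eval (E (K • v)) = 0 := fun v hv hne => by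
      rw [Polynomial.eval_prod]
      exact Finset.prod_eq_zero (Finset.mem_erase.2 ⟨hne, hv⟩) (by simp)
    calc _ = ∑ v ∈ F.coeff.support, (F.coeff v : ℂ) • (E v * P.eval (E (K • v))) := by
          simp only [hdil, Finset.mul_sum, Polynomial.eval_eq_sum, Polynomial.sum_def,
            Finset.smul_sum]
          rw [Finset.sum_comm]
          refine Finset.sum_congr rfl fun v _ => Finset.sum_congr rfl fun i _ => ?_
          rw [mul_smul_comm]
          congr 1
          ring
      _ = _ := by
          refine Finset.sum_eq_single_of_mem v₀ hv₀ fun v hv hne => ?_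
          rw [hone v hv hne, mul_zero, smul_zero]
  have hzero : act ((F.coeff v₀ : ℂ) • (E v₀ * P.eval (E (K • v₀)))) c = 0 := by
    rw [← hkey, act_sum_left]
    refine Finset.sum_eq_zero fun i _ => ?_
    rw [act_mul, act_dilate_one_add_mul_factorial hint hB F hN h1, act_zero_right]
  rw [act_smul_left, smul_eq_zero, or_iff_right (by simpa using hv₀),
    act_isUnit_mul _ (isUnit_single _ one_ne_zero)] at hzero
  refine ⟨s.toList.map (fun v => K • (v₀ - v)), ?_, ?_⟩
  · intro u hu
    obtain ⟨v, hv, rfl⟩ := List.mem_map.1 hu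
    have hv := (Finset.mem_erase.1 (Finset.mem_toList.1 hv)).1
    rw [← Nat.cast_smul_eq_nsmul ℤ]
    exact smul_ne_zero hK0 (sub_ne_zero.2 hv.symm)
  · rw [List.map_map, Finset.prod_map_toList]
    rw [Polynomial.eval_prod] at hzero
    have : ∏ v ∈ s, (Polynomial.X - Polynomial.C (E (K • v))).eval (E (K • v₀)) =
        (∏ v ∈ s, E (K • v)) * ∏ v ∈ s, binom (K • (v₀ - v)) := by
      rw [← Finset.prod_mul_distrib]
      refine Finset.prod_congr rfl fun v _ => ?_
      have : E (K • v₀) = E (K • v) * E (K • (v₀ - v)) := by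
        rw [← hEadd, ← smul_add, add_sub_cancel]
      rw [Polynomial.eval_sub, Polynomial.eval_X, Polynomial.eval_C, this, binom]
      change _ = E (K • v) * (E _ - 1)
      ring
    rw [this, act_isUnit_mul _ (by
      exact Finset.prod_induction _ IsUnit (fun _ _ => IsUnit.mul) isUnit_one
        fun v _ => isUnit_single _ one_ne_zero)] at hzero
    exact hzero

end Binomial

/-! ### Polynomials supported on a line -/

section Along

open MvPolynomial

/-- The support of `f` lies on a line parallel to `u`. -/
def IsAlong (u : Fin 2 → ℤ) (f : MvPolynomial (Fin 2) ℂ) : Prop :=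
  ∃ n : ℤ, ∀ s ∈ f.support, det u (expCast 2 s) = n

/-- With respect to an injective additive map of exponents to a linear order, the leading exponents
of two factors add up to an exponent of the product. -/
lemma exists_isMax_add_mem_support {σ Γ : Type*} [AddCommMonoid Γ] [LinearOrder Γ]
    [IsOrderedCancelAddMonoid Γ] (D : (σ →₀ ℕ) →+ Γ) (hD : Function.Injective D)
    {f g : MvPolynomial σ ℂ} (hf : f ≠ 0) (hg : g ≠ 0) :
    ∃ a ∈ f.support, ∃ b ∈ g.support, (∀ s ∈ f.support, D s ≤ D a) ∧ (∀ s ∈ g.support, D s ≤ D b) ∧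
      a + b ∈ (f * g).support := by
  classical
  obtain ⟨a, ha, ha'⟩ := f.support.exists_max_image D (support_nonempty.2 hf)
  obtain ⟨b, hb, hb'⟩ := g.support.exists_max_image D (support_nonempty.2 hg)
  refine ⟨a, ha, b, hb, ha', hb', ?_⟩
  rw [mem_support_iff, coeff_mul, Finset.sum_eq_single_of_mem (a, b) (by simp)]
  · exact mul_ne_zero (mem_support_iff.1 ha) (mem_support_iff.1 hb)
  · rintro ⟨x, y⟩ hxy hne
    rw [HasAntidiagonal.mem_antidiagonal] at hxy
    by_contra h0
    have hx := ha' x (mem_support_iff.2 (left_ne_zero_of_mul h0))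
    have hy := hb' y (mem_support_iff.2 (right_ne_zero_of_mul h0))
    have hsum : D x + D y = D a + D b := by rw [← map_add, ← map_add, hxy]
    have hxa : D x = D a := by
      refine hx.antisymm (le_of_not_gt fun hlt => ?_)
      exact (add_lt_add_of_lt_of_le hlt hy).ne hsum
    have hyb : D y = D b := by rw [hxa] at hsum; exact add_left_cancel hsum
    exact hne (Prod.ext (hD hxa) (hD hyb))

/-- The ordering of exponents by `ℓ`, ties being broken lexicographically. -/
noncomputable def lexOrd (ℓ : (Fin 2 →₀ ℕ) →+ ℤ) : (Fin 2 →₀ ℕ) →+ ℤ ×ₗ ℕ ×ₗ ℕ where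
  toFun s := toLex (ℓ s, toLex (s 0, s 1))
  map_zero' := by simp
  map_add' s t := by simp; rfl

lemma lexOrd_injective (ℓ : (Fin 2 →₀ ℕ) →+ ℤ) : Function.Injective (lexOrd ℓ) := by
  intro s t h
  have h' : (ℓ s, toLex (s 0, s 1)) = (ℓ t, toLex (t 0, t 1)) := toLex.injective h
  have h2 : (s 0, s 1) = (t 0, t 1) := toLex.injective (Prod.ext_iff.1 h').2
  ext i
  fin_cases i
  · exact (Prod.ext_iff.1 h2).1
  · exact (Prod.ext_iff.1 h2).2

lemma le_of_lexOrd_le {ℓ : (Fin 2 →₀ ℕ) →+ ℤ} {s t : Fin 2 →₀ ℕ} (h : lexOrd ℓ s ≤ lexOrd ℓ t) :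
    ℓ s ≤ ℓ t := Prod.Lex.monotone_fst _ _ h

/-- The functional `det u` on exponents. -/
noncomputable def detHom (u : Fin 2 → ℤ) : (Fin 2 →₀ ℕ) →+ ℤ where
  toFun s := det u (expCast 2 s)
  map_zero' := by simp [det]
  map_add' s t := by simp [det]; ring

/-- The width of the support in a given direction is additive under products, so a divisor of a
polynomial supported on a line is supported on a parallel line. -/
lemma IsAlong.of_dvd {u : Fin 2 → ℤ} {f g : MvPolynomial (Fin 2) ℂ} (hf : IsAlong u f)
    (hf0 : f ≠ 0) (hgf : g ∣ f) : IsAlong u g := by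
  obtain ⟨q, rfl⟩ := hgf
  have hg0 := left_ne_zero_of_mul hf0
  have hq0 := right_ne_zero_of_mul hf0
  obtain ⟨n, hn⟩ := hf
  obtain ⟨a, ha, b, hb, hamax, hbmax, hab⟩ :=
    exists_isMax_add_mem_support _ (lexOrd_injective (detHom u)) hg0 hq0
  obtain ⟨a', ha', b', hb', hamin, hbmin, hab'⟩ :=
    exists_isMax_add_mem_support _ (lexOrd_injective (-detHom u)) hg0 hq0
  have h1 : detHom u a + detHom u b = n := by rw [← map_add]; exact hn _ hab
  have h2 : detHom u a' + detHom u b' = n := by rw [← map_add]; exact hn _ hab'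
  have h3 := le_of_lexOrd_le (hbmax b' hb')
  refine ⟨detHom u a, fun s hs => ?_⟩
  have h4 := le_of_lexOrd_le (hamax s hs)
  have h5 := le_of_lexOrd_le (hamin s hs)
  simp only [AddMonoidHom.neg_apply] at h5
  change detHom u s = _
  omega

lemma eq_zero_of_det_eq_zero {u w x : Fin 2 → ℤ} (huw : det u w ≠ 0) (hu : det u x = 0)
    (hw : det w x = 0) : x = 0 := by
  simp only [det] at *
  have h0 : (u 0 * w 1 - u 1 * w 0) * x 0 = 0 := by linear_combination w 0 * hu - u 0 * hw
  have h1 : (u 0 * w 1 - u 1 * w 0) * x 1 = 0 := by linear_combination w 1 * hu - u 1 * hw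
  ext i
  fin_cases i
  · exact (mul_eq_zero.1 h0).resolve_left huw
  · exact (mul_eq_zero.1 h1).resolve_left huw

lemma det_sub (u x y : Fin 2 → ℤ) : det u (x - y) = det u x - det u y := by
  simp [det]; ring

lemma det_comm (u w : Fin 2 → ℤ) : det u w = -det w u := by
  simp [det]; ring

/-- A polynomial supported on lines in two different directions is a monomial. -/
lemma IsAlong.subsingleton_support {u w : Fin 2 → ℤ} (huw : det u w ≠ 0)
    {f : MvPolynomial (Fin 2) ℂ} (hu : IsAlong u f) (hw : IsAlong w f) :
    (f.support : Set (Fin 2 →₀ ℕ)).Subsingleton := by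
  obtain ⟨m, hm⟩ := hu
  obtain ⟨n, hn⟩ := hw
  intro s hs t ht
  refine expCast_injective (sub_eq_zero.1 (eq_zero_of_det_eq_zero huw ?_ ?_))
  · rw [det_sub, hm s hs, hm t ht, sub_self]
  · rw [det_sub, hn s hs, hn t ht, sub_self]

lemma isUnit_of_subsingleton_support {f : MvPolynomial (Fin 2) ℂ} (hf : f ≠ 0)
    (hX : ∀ i, ¬ X i ∣ f) (hs : (f.support : Set (Fin 2 →₀ ℕ)).Subsingleton) : IsUnit f := by
  classical
  obtain ⟨s, hs'⟩ := support_nonempty.2 hf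
  have hf' : f = monomial s (f.coeff s) := by
    ext t
    rw [coeff_monomial]
    split_ifs with h
    · rw [h]
    · by_contra h0
      exact h (hs hs' (mem_support_iff.2 h0))
  have hs0 : s = 0 := by
    ext i
    by_contra hi
    exact hX i (hf' ▸ X_dvd_monomial.2 (Or.inr hi))
  rw [hf', hs0]
  exact (isUnit_iff_ne_zero.2 (by rw [← hs0]; exact mem_support_iff.1 hs')).map C

lemma isRelPrime_of_isAlong {u w : Fin 2 → ℤ} (huw : det u w ≠ 0) {f g : MvPolynomial (Fin 2) ℂ}
    (hf0 : f ≠ 0) (hg0 : g ≠ 0) (hX : ∀ i, ¬ X i ∣ f) (hf : IsAlong u f) (hg : IsAlong w g) :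
    IsRelPrime f g := by
  intro q hqf hqg
  exact isUnit_of_subsingleton_support (ne_zero_of_dvd_ne_zero hf0 hqf)
    (fun i h => hX i (h.trans hqf))
    ((hf.of_dvd hf0 hqf).subsingleton_support huw (hg.of_dvd hg0 hqg))

/-- The binomial `X^u - 1` cleared of denominators: `X^(u⁺) - X^(u⁻)`. -/
noncomputable def polyBinom (u : Fin 2 → ℤ) : MvPolynomial (Fin 2) ℂ :=
  monomial (Finsupp.equivFunOnFinite.symm fun i => (u i).toNat) 1 -
    monomial (Finsupp.equivFunOnFinite.symm fun i => (-u i).toNat) 1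

lemma toLaurent_polyBinom (u : Fin 2 → ℤ) :
    ∃ w : Laurent 2, IsUnit w ∧ toLaurent 2 (polyBinom u) = w * binom u := by
  refine ⟨_, isUnit_toLaurent_monomial (Finsupp.equivFunOnFinite.symm fun i => (-u i).toNat)
    one_ne_zero, ?_⟩
  rw [polyBinom, binom, map_sub, mul_sub, mul_one]
  congr 1
  rw [toLaurent_monomial, toLaurent_monomial, AddMonoidAlgebra.single_mul_single, one_mul]
  congr 1
  ext i
  simp [expCast]
  omega

lemma polyBinom_mem_Ann {u : Fin 2 → ℤ} {c : Config 2} : polyBinom u ∈ Ann c ↔ HasPeriod c u := by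
  obtain ⟨w, hw, h⟩ := toLaurent_polyBinom u
  rw [mem_Ann, h, act_isUnit_mul _ hw, act_binom_eq_zero_iff]

lemma isAlong_polyBinom (u : Fin 2 → ℤ) : IsAlong u (polyBinom u) := by
  classical
  have key : det u (expCast 2 (Finsupp.equivFunOnFinite.symm fun i => (u i).toNat)) =
      det u (expCast 2 (Finsupp.equivFunOnFinite.symm fun i => (-u i).toNat)) := by
    rw [← sub_eq_zero, ← det_sub]
    have : expCast 2 (Finsupp.equivFunOnFinite.symm fun i => (u i).toNat) -
        expCast 2 (Finsupp.equivFunOnFinite.symm fun i => (-u i).toNat) = u := by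
      ext i
      simp [expCast]
    rw [this, det]
    ring
  refine ⟨det u (expCast 2 (Finsupp.equivFunOnFinite.symm fun i => (u i).toNat)), fun s hs => ?_⟩
  rcases Finset.mem_union.1 (support_sub _ _ _ hs) with h | h
  · rw [Finset.mem_singleton.1 (support_monomial_subset h)]
  · rw [Finset.mem_singleton.1 (support_monomial_subset h), key]

lemma polyBinom_ne_zero {u : Fin 2 → ℤ} (hu : u ≠ 0) : polyBinom u ≠ 0 := by
  intro h
  obtain ⟨i, hi⟩ := Function.ne_iff.1 hu
  have := monomial_left_injective (one_ne_zero (α := ℂ)) (sub_eq_zero.1 h)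
  have := DFunLike.congr_fun this i
  simp at this hi
  omega

lemma list_prod_polyBinom_mem_Ann {L : List (Fin 2 → ℤ)} {c : Config 2} :
    (L.map polyBinom).prod ∈ Ann c ↔ act (L.map binom).prod c = 0 := by
  have h : ∃ w : Laurent 2, IsUnit w ∧
      toLaurent 2 (L.map polyBinom).prod = w * (L.map binom).prod := by
    induction L with
    | nil => exact ⟨1, isUnit_one, by simp⟩
    | cons u L ih =>
      obtain ⟨w, hw, h⟩ := toLaurent_polyBinom u
      obtain ⟨w', hw', h'⟩ := ih
      refine ⟨w * w', hw.mul hw', ?_⟩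
      rw [List.map_cons, List.prod_cons, List.map_cons, List.prod_cons, map_mul, h, h']
      ring
  obtain ⟨w, hw, h⟩ := h
  rw [mem_Ann, h, act_isUnit_mul _ hw]

/-! ### Line polynomials and their directions -/

lemma toRat_sub {d : ℕ} (u w : Fin d → ℤ) : toRat (u - w) = toRat u - toRat w := by
  ext i; simp [toRat]

lemma toRat_zsmul {d : ℕ} (k : ℤ) (u : Fin d → ℤ) : toRat (k • u) = (k : ℚ) • toRat u := by
  ext i; simp [toRat]

lemma toRat_mem_span_iff {u w : Fin 2 → ℤ} (hu : u ≠ 0) :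
    toRat w ∈ Submodule.span ℚ {toRat u} ↔ det u w = 0 := by
  rw [Submodule.mem_span_singleton]
  constructor
  · rintro ⟨r, hr⟩
    have h : ∀ i, (w i : ℚ) = r * u i := fun i => (congrFun hr i).symm
    have : ((det u w : ℤ) : ℚ) = 0 := by
      simp only [det]
      push_cast
      rw [h, h]
      ring
    exact_mod_cast this
  · intro h
    by_cases hw : w = 0
    · exact ⟨0, by ext i; simp [hw, toRat]⟩
    obtain ⟨t, k, l, ht, rfl, hl⟩ := exists_common_multiple_of_det_eq_zero hu hw h
    have hl0 : (l : ℚ) ≠ 0 := by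
      rintro h0
      rw [Int.cast_eq_zero] at h0
      exact ht (by rw [hl, h0, zero_smul])
    refine ⟨k / l, ?_⟩
    have := congrArg toRat hl
    rw [toRat_zsmul, toRat_zsmul] at this
    rw [div_eq_inv_mul, mul_smul, this, inv_smul_smul₀ hl0]

lemma span_toRat_eq {u w : Fin 2 → ℤ} (hu : u ≠ 0) (hw : w ≠ 0) (h : det u w = 0) :
    Submodule.span ℚ {toRat u} = Submodule.span ℚ {toRat w} := by
  refine le_antisymm ?_ ?_
  · rw [Submodule.span_singleton_le_iff_mem, toRat_mem_span_iff hw, det_comm, h, neg_zero]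
  · rw [Submodule.span_singleton_le_iff_mem, toRat_mem_span_iff hu, h]

lemma mem_suppRat {f : MvPolynomial (Fin 2) ℂ} {p : Fin 2 → ℚ} :
    p ∈ suppRat (toLaurent 2 f) ↔ ∃ s ∈ f.support, toRat (expCast 2 s) = p := by
  rw [suppRat, toLaurent_support]
  simp

lemma toRat_injective {d : ℕ} : Function.Injective (toRat (d := d)) := by
  intro u w h
  ext i
  exact Int.cast_injective (α := ℚ) (congrFun h i)

/-- A line polynomial is supported along an integral vector spanning its direction. -/
lemma IsLine.exists_isAlong {f : MvPolynomial (Fin 2) ℂ} (hf : IsLine (toLaurent 2 f)) :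
    ∃ u : Fin 2 → ℤ, u ≠ 0 ∧ IsAlong u f ∧
      direction (toLaurent 2 f) = Submodule.span ℚ {toRat u} := by
  obtain ⟨hnt, hcol⟩ := hf
  obtain ⟨p, hp, q, hq, hpq⟩ := hnt
  obtain ⟨v, hv⟩ := (collinear_iff_of_mem hp).1 hcol
  have hpq' : q - p ∈ direction (toLaurent 2 f) := vsub_mem_vectorSpan ℚ hq hp
  obtain ⟨s, hs, rfl⟩ := mem_suppRat.1 hp
  obtain ⟨t, ht, rfl⟩ := mem_suppRat.1 hq
  have hu0 : expCast 2 t - expCast 2 s ≠ 0 := by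
    rw [sub_ne_zero]
    rintro h
    exact hpq (by rw [h])
  rw [← toRat_sub] at hpq'
  have hdir : direction (toLaurent 2 f) =
      Submodule.span ℚ {toRat (expCast 2 t - expCast 2 s)} := by
    refine le_antisymm ?_ ((Submodule.span_singleton_le_iff_mem _ _).2 hpq')
    obtain ⟨r, hr⟩ := hv _ hq
    have hr' : toRat (expCast 2 t - expCast 2 s) = r • v := by
      rw [toRat_sub, hr, vadd_eq_add, add_sub_cancel_right]
    have hr0 : r ≠ 0 := by
      rintro rfl
      exact hpq (by rw [hr]; simp)
    have hvmem : v ∈ Submodule.span ℚ {toRat (expCast 2 t - expCast 2 s)} :=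
      Submodule.mem_span_singleton.2 ⟨r⁻¹, by rw [hr', inv_smul_smul₀ hr0]⟩
    rw [direction, vectorSpan_def, Submodule.span_le]
    rintro _ ⟨x, hx, y, hy, rfl⟩
    obtain ⟨a, ha⟩ := hv x hx
    obtain ⟨b, hb⟩ := hv y hy
    have : x -ᵥ y = (a - b) • v := by
      rw [ha, hb, vsub_eq_sub, vadd_eq_add, vadd_eq_add, add_sub_add_right_eq_sub, sub_smul]
    change x -ᵥ y ∈ Submodule.span ℚ _
    rw [this]
    exact Submodule.smul_mem _ _ hvmem
  refine ⟨_, hu0, ⟨det (expCast 2 t - expCast 2 s) (expCast 2 s), fun x hx => ?_⟩, hdir⟩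
  have hmem : toRat (expCast 2 x) - toRat (expCast 2 s) ∈ direction (toLaurent 2 f) :=
    vsub_mem_vectorSpan ℚ (mem_suppRat.2 ⟨x, hx, rfl⟩) hp
  rwa [hdir, ← toRat_sub, toRat_mem_span_iff hu0, det_sub, sub_eq_zero] at hmem

lemma IsLine.nontrivial_support {f : MvPolynomial (Fin 2) ℂ} (hf : IsLine (toLaurent 2 f)) :
    (f.support : Set (Fin 2 →₀ ℕ)).Nontrivial := by
  obtain ⟨p, hp, q, hq, hpq⟩ := hf.1
  obtain ⟨s, hs, rfl⟩ := mem_suppRat.1 hp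
  obtain ⟨t, ht, rfl⟩ := mem_suppRat.1 hq
  exact ⟨s, hs, t, ht, fun h => hpq (by rw [h])⟩

lemma IsLine.ne_zero {f : MvPolynomial (Fin 2) ℂ} (hf : IsLine (toLaurent 2 f)) : f ≠ 0 := by
  rintro rfl
  obtain ⟨s, hs, -⟩ := hf.nontrivial_support
  simp at hs

lemma IsLine.direction_eq {f : MvPolynomial (Fin 2) ℂ} (hf : IsLine (toLaurent 2 f))
    {u : Fin 2 → ℤ} (hu : u ≠ 0) (h : IsAlong u f) :
    direction (toLaurent 2 f) = Submodule.span ℚ {toRat u} := by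
  obtain ⟨w, hw, hwf, hdir⟩ := hf.exists_isAlong
  rw [hdir]
  refine span_toRat_eq hw hu ?_
  by_contra hdet
  exact Set.not_subsingleton_iff.2 hf.nontrivial_support (hwf.subsingleton_support hdet h)

lemma IsAlong.isLine {f : MvPolynomial (Fin 2) ℂ} {u : Fin 2 → ℤ} (hu : u ≠ 0) (h : IsAlong u f)
    (hs : (f.support : Set (Fin 2 →₀ ℕ)).Nontrivial) : IsLine (toLaurent 2 f) := by
  obtain ⟨s, hs, t, ht, hst⟩ := hs
  obtain ⟨n, hn⟩ := h
  refine ⟨⟨_, mem_suppRat.2 ⟨s, hs, rfl⟩, _, mem_suppRat.2 ⟨t, ht, rfl⟩, fun h =>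
    hst (expCast_injective (toRat_injective h))⟩, ?_⟩
  refine (collinear_iff_of_mem (mem_suppRat.2 ⟨s, hs, rfl⟩)).2 ⟨toRat u, fun p hp => ?_⟩
  obtain ⟨x, hx, rfl⟩ := mem_suppRat.1 hp
  have hmem : toRat (expCast 2 x - expCast 2 s) ∈ Submodule.span ℚ {toRat u} := by
    rw [toRat_mem_span_iff hu, det_sub, hn x hx, hn s hs, sub_self]
  obtain ⟨r, hr⟩ := Submodule.mem_span_singleton.1 hmem
  exact ⟨r, by rw [hr, toRat_sub, vadd_eq_add, sub_add_cancel]⟩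

/-- In a product of binomials in pairwise distinct directions, a line polynomial can only divide
the binomial in its own direction. -/
lemma exists_dvd_polyBinom {f : MvPolynomial (Fin 2) ℂ} {w : Fin 2 → ℤ} (hw : w ≠ 0)
    (hf : IsAlong w f) (hf0 : f ≠ 0) (hX : ∀ i, ¬ X i ∣ f) (hunit : ¬ IsUnit f)
    {L : List (Fin 2 → ℤ)} (h0 : ∀ u ∈ L, u ≠ 0) (hL : L.Pairwise (fun u w => det u w ≠ 0))
    (hdvd : f ∣ (L.map polyBinom).prod) : ∃ u ∈ L, det w u = 0 ∧ f ∣ polyBinom u := by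
  have hrel : ∀ u : Fin 2 → ℤ, u ≠ 0 → det w u ≠ 0 → IsRelPrime f (polyBinom u) := fun u hu hd =>
    isRelPrime_of_isAlong hd hf0 (polyBinom_ne_zero hu) hX hf (isAlong_polyBinom u)
  induction L with
  | nil => exact absurd (isUnit_of_dvd_one (by simpa using hdvd)) hunit
  | cons u L ih =>
    rw [List.map_cons, List.prod_cons] at hdvd
    rw [List.pairwise_cons] at hL
    by_cases hd : det w u = 0
    · refine ⟨u, by simp, hd, IsRelPrime.dvd_of_dvd_mul_right ?_ hdvd⟩
      have hrel' : ∀ x ∈ L, IsRelPrime f (polyBinom x) := fun x hx => by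
        refine hrel x (h0 x (by simp [hx])) fun hdx => hw ?_
        refine eq_zero_of_det_eq_zero (hL.1 x hx) ?_ ?_
        · rw [det_comm, hd, neg_zero]
        · rw [det_comm, hdx, neg_zero]
      clear ih hdvd h0 hL
      induction L with
      | nil => simpa using isRelPrime_one_right
      | cons x L ih =>
        rw [List.map_cons, List.prod_cons]
        exact (hrel' x (by simp)).mul_right (ih fun y hy => hrel' y (by simp [hy]))
    · obtain ⟨x, hx, h1, h2⟩ := ih (fun x hx => h0 x (by simp [hx])) hL.2
        ((hrel u (h0 u (by simp)) hd).dvd_of_dvd_mul_left hdvd)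
      exact ⟨x, by simp [hx], h1, h2⟩

end Along

/-! ### Elimination and extraction of a greatest common divisor -/

section Elimination

open MvPolynomial

/-- In a polynomial ring over a factorial domain, the ideal generated by an irreducible polynomial
and a non-multiple of it contains a non-zero constant. -/
lemma exists_C_mem_span_pair {A : Type*} [CommRing A] [IsDomain A] [UniqueFactorizationMonoid A]
    {f h : Polynomial A} (hf : Irreducible f) (hfh : ¬ f ∣ h) :
    ∃ a : A, a ≠ 0 ∧ Polynomial.C a ∈ Ideal.span {f, h} := by
  classical
  let _ : NormalizedGCDMonoid A := Classical.choice inferInstance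
  by_cases hdeg : f.natDegree = 0
  · obtain ⟨a, rfl⟩ := Polynomial.natDegree_eq_zero.1 hdeg
    exact ⟨a, by rintro rfl; exact hf.ne_zero (map_zero _), Ideal.subset_span (by simp)⟩
  let K := FractionRing A
  have hprim : f.IsPrimitive := hf.isPrimitive hdeg
  have hirr : Irreducible (f.map (algebraMap A K)) :=
    hprim.irreducible_iff_irreducible_map_fraction_map.1 hf
  have hcop : IsCoprime (f.map (algebraMap A K)) (h.map (algebraMap A K)) := by
    rw [hirr.coprime_iff_not_dvd]
    exact fun hdvd => hfh (hprim.dvd_of_fraction_map_dvd_fraction_map (K := K) hdvd)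
  -- clear the denominators in a Bézout relation over the fraction field
  obtain ⟨p, q, hpq⟩ := hcop
  obtain ⟨a, ha, hap⟩ := IsLocalization.integerNormalization_spec (nonZeroDivisors A) p
  obtain ⟨b, hb, hbq⟩ := IsLocalization.integerNormalization_spec (nonZeroDivisors A) q
  set P := IsLocalization.integerNormalization (nonZeroDivisors A) p
  set Q := IsLocalization.integerNormalization (nonZeroDivisors A) q
  refine ⟨a * b, mul_ne_zero (nonZeroDivisors.ne_zero ha) (nonZeroDivisors.ne_zero hb), ?_⟩
  rw [Ideal.mem_span_pair]
  refine ⟨Polynomial.C b * P, Polynomial.C a * Q, ?_⟩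
  refine Polynomial.map_injective _ (IsFractionRing.injective A K) ?_
  simp only [Polynomial.map_add, Polynomial.map_mul, Polynomial.map_C, hap, hbq, map_mul]
  simp only [Algebra.smul_def, Polynomial.algebraMap_apply]
  linear_combination (Polynomial.C (algebraMap A K a) * Polynomial.C (algebraMap A K b)) * hpq

/-- The last variable can be eliminated from an irreducible polynomial and a non-multiple. -/
lemma exists_aeval_X_one_mem_span_pair {f h : MvPolynomial (Fin 2) ℂ} (hf : Irreducible f)
    (hfh : ¬ f ∣ h) : ∃ p : Polynomial ℂ, p ≠ 0 ∧
      Polynomial.aeval (X 1 : MvPolynomial (Fin 2) ℂ) p ∈ Ideal.span {f, h} := by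
  let e := finSuccEquiv ℂ 1
  obtain ⟨a, ha0, ha⟩ := exists_C_mem_span_pair (f := e f) (h := e h)
    ((MulEquiv.irreducible_iff e).2 hf) (fun hd => hfh ((map_dvd_iff e).1 hd))
  have hback : ∀ a : MvPolynomial (Fin 1) ℂ, Polynomial.aeval (X 0 : MvPolynomial (Fin 1) ℂ)
      (aeval (fun _ => (Polynomial.X : Polynomial ℂ)) a) = a := fun a => by
    induction a using MvPolynomial.induction_on with
    | C z => simp
    | add p q hp hq => rw [map_add, map_add, hp, hq]
    | mul_X p i hp => rw [map_mul, map_mul, hp, aeval_X, Polynomial.aeval_X, Subsingleton.elim i 0]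
  refine ⟨aeval (fun _ => Polynomial.X) a, fun h0 => ha0 ?_, ?_⟩
  · rw [← hback a, h0, map_zero]
  · have hea : e (Polynomial.aeval (X 1 : MvPolynomial (Fin 2) ℂ)
        (aeval (fun _ => (Polynomial.X : Polynomial ℂ)) a)) = Polynomial.C a := by
      have h1 : e (X 1) = Polynomial.C (X 0) := finSuccEquiv_X_succ (R := ℂ) (j := (0 : Fin 1))
      conv_rhs => rw [← hback a]
      rw [← AlgEquiv.coe_toAlgHom, ← Polynomial.aeval_algHom_apply, AlgEquiv.coe_toAlgHom, h1]
      exact Polynomial.aeval_algebraMap_apply _ (X 0 : MvPolynomial (Fin 1) ℂ) _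
    rw [Ideal.mem_span_pair] at ha ⊢
    obtain ⟨x, y, hxy⟩ := ha
    refine ⟨e.symm x, e.symm y, e.injective ?_⟩
    rw [hea, map_add, map_mul, map_mul, e.apply_symm_apply, e.apply_symm_apply, hxy]

lemma exists_aeval_X_mem_span_pair {f h : MvPolynomial (Fin 2) ℂ} (hf : Irreducible f)
    (hfh : ¬ f ∣ h) (i : Fin 2) : ∃ p : Polynomial ℂ, p ≠ 0 ∧
      Polynomial.aeval (X i : MvPolynomial (Fin 2) ℂ) p ∈ Ideal.span {f, h} := by
  let e := renameEquiv ℂ (Equiv.swap i 1)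
  obtain ⟨p, hp0, hp⟩ := exists_aeval_X_one_mem_span_pair (f := e f) (h := e h)
    ((MulEquiv.irreducible_iff e).2 hf) (fun hd => hfh ((map_dvd_iff e).1 hd))
  refine ⟨p, hp0, ?_⟩
  have hei : e (Polynomial.aeval (X i) p) = Polynomial.aeval (X 1) p := by
    rw [← Polynomial.aeval_algHom_apply]
    simp [e]
  rw [Ideal.mem_span_pair] at hp ⊢
  obtain ⟨x, y, hxy⟩ := hp
  refine ⟨e.symm x, e.symm y, e.injective ?_⟩
  rw [hei, map_add, map_mul, map_mul, e.apply_symm_apply, e.apply_symm_apply, hxy]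

/-- An ideal of `ℂ[x, y]` without common factor contains non-zero polynomials in one variable:
every irreducible factor of an element of `J` is eliminated against an element of `J` which it
does not divide. -/
lemma exists_aeval_X_mem {J : Ideal (MvPolynomial (Fin 2) ℂ)} (hJ0 : J ≠ ⊥)
    (hJ : ∀ q, (∀ f ∈ J, q ∣ f) → IsUnit q) (i : Fin 2) :
    ∃ p : Polynomial ℂ, p ≠ 0 ∧ Polynomial.aeval (X i : MvPolynomial (Fin 2) ℂ) p ∈ J := by
  obtain ⟨g, hgJ, hg0⟩ := Submodule.exists_mem_ne_zero_of_ne_bot hJ0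
  have key : ∀ g : MvPolynomial (Fin 2) ℂ, g ≠ 0 → ∃ p : Polynomial ℂ, p ≠ 0 ∧
      Polynomial.aeval (X i : MvPolynomial (Fin 2) ℂ) p ∈ Ideal.span {g} ⊔ J := by
    intro g
    induction g using WfDvdMonoid.induction_on_irreducible with
    | zero => exact fun h => absurd rfl h
    | unit u hu =>
      intro _
      refine ⟨1, one_ne_zero, ?_⟩
      rw [Ideal.span_singleton_eq_top.2 hu]
      exact Submodule.mem_sup_left trivial
    | mul g f hg0 hf ih =>
      intro _
      obtain ⟨p, hp0, hp⟩ := ih hg0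
      obtain ⟨h, hhJ, hfh⟩ : ∃ h ∈ J, ¬ f ∣ h := by
        by_contra! hall
        exact hf.not_isUnit (hJ f hall)
      obtain ⟨q, hq0, hq⟩ := exists_aeval_X_mem_span_pair hf hfh i
      refine ⟨q * p, mul_ne_zero hq0 hp0, ?_⟩
      rw [map_mul]
      have hq' : Polynomial.aeval (X i : MvPolynomial (Fin 2) ℂ) q ∈ Ideal.span {f} ⊔ J := by
        refine (Ideal.span_le.2 ?_ : Ideal.span {f, h} ≤ _) hq
        rintro x (rfl | rfl)
        · exact Submodule.mem_sup_left (Ideal.mem_span_singleton_self _)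
        · exact Submodule.mem_sup_right hhJ
      rw [Ideal.mem_span_singleton_sup] at hp hq' ⊢
      obtain ⟨a, x, hx, hp⟩ := hp
      obtain ⟨b, y, hy, hq⟩ := hq'
      refine ⟨b * a, b * f * x + y * (a * g + x), J.add_mem (J.mul_mem_left _ hx)
        (J.mul_mem_right _ hy), ?_⟩
      rw [← hp, ← hq]
      ring
  obtain ⟨p, hp0, hp⟩ := key g hg0
  refine ⟨p, hp0, ?_⟩
  rwa [sup_eq_right.2 ((Ideal.span_singleton_le_iff_mem J).2 hgJ)] at hp

/-- A non-zero ideal of `ℂ[x, y]` is the product of a principal ideal and an ideal whose elements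
have no common factor. -/
lemma exists_eq_span_mul (I : Ideal (MvPolynomial (Fin 2) ℂ)) (hI : I ≠ ⊥) :
    ∃ (φ : MvPolynomial (Fin 2) ℂ) (J : Ideal (MvPolynomial (Fin 2) ℂ)), φ ≠ 0 ∧
      I = Ideal.span {φ} * J ∧ ∀ q, (∀ f ∈ J, q ∣ f) → IsUnit q := by
  classical
  obtain ⟨g, hgI, hg0⟩ := Submodule.exists_mem_ne_zero_of_ne_bot hI
  let Q : ℕ → Prop := fun n => ∃ φ : MvPolynomial (Fin 2) ℂ, φ.totalDegree = n ∧ ∀ f ∈ I, φ ∣ f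
  have hbound : ∀ φ : MvPolynomial (Fin 2) ℂ, (∀ f ∈ I, φ ∣ f) →
      φ.totalDegree ≤ g.totalDegree := fun φ hφ => by
    obtain ⟨q, hq⟩ := hφ g hgI
    have h1 : φ ≠ 0 := by rintro rfl; exact hg0 (by simpa using hq)
    have h2 : q ≠ 0 := by rintro rfl; exact hg0 (by simpa using hq)
    rw [hq, totalDegree_mul_of_isDomain h1 h2]
    omega
  -- a common divisor of maximal degree is a greatest common divisor
  obtain ⟨φ, hφdeg, hφ⟩ : Q (Nat.findGreatest Q g.totalDegree) :=
    Nat.findGreatest_spec (P := Q) (Nat.zero_le _) ⟨1, by simp, fun f _ => one_dvd f⟩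
  have hφ0 : φ ≠ 0 := by
    rintro rfl
    exact hg0 (by simpa using hφ g hgI)
  have hmul : I = Ideal.span {φ} * Submodule.comap (LinearMap.mulLeft _ φ) I := by
    ext f
    rw [Ideal.mem_span_singleton_mul]
    constructor
    · intro hf
      obtain ⟨q, rfl⟩ := hφ f hf
      exact ⟨q, hf, rfl⟩
    · rintro ⟨q, hq, rfl⟩
      exact hq
  refine ⟨φ, _, hφ0, hmul, fun q hq => ?_⟩
  have hφq : ∀ f ∈ I, φ * q ∣ f := fun f hf => by
    rw [hmul, Ideal.mem_span_singleton_mul] at hf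
    obtain ⟨z, hz, rfl⟩ := hf
    exact mul_dvd_mul_left φ (hq z hz)
  have hq0 : q ≠ 0 := by
    rintro rfl
    exact hg0 (by simpa using hφq g hgI)
  have hle := Nat.le_findGreatest (P := Q) (hbound _ hφq) ⟨_, rfl, hφq⟩
  rw [totalDegree_mul_of_isDomain hφ0 hq0, ← hφdeg] at hle
  have hC := totalDegree_eq_zero_iff_eq_C.1 (by omega : q.totalDegree = 0)
  rw [hC]
  exact (isUnit_iff_ne_zero.2 fun h => hq0 (by rw [hC, h, map_zero])).map C

/-- An ideal containing non-zero polynomials in each single variable is not contained in `(X i)`: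
a polynomial in the other variable is not divisible by `X i`. -/
lemma exists_mem_not_X_dvd {H : Ideal (MvPolynomial (Fin 2) ℂ)}
    (hH : ∀ i, ∃ p : Polynomial ℂ, p ≠ 0 ∧
      Polynomial.aeval (X i : MvPolynomial (Fin 2) ℂ) p ∈ H) (i : Fin 2) :
    ∃ f ∈ H, ¬ X i ∣ f := by
  obtain ⟨j, hj⟩ := exists_ne i
  obtain ⟨p, hp0, hp⟩ := hH j
  refine ⟨_, hp, fun ⟨q, hq⟩ => hp0 ?_⟩
  -- evaluate at `X i = 0`
  have := congrArg
    (MvPolynomial.aeval (fun k => if k = i then (0 : Polynomial ℂ) else Polynomial.X)) hq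
  rw [map_mul, aeval_X, if_pos rfl, zero_mul, ← Polynomial.aeval_algHom_apply, aeval_X,
    if_neg hj] at this
  simpa using this

/-- If `Ann c = φ J` and `J` is not contained in `(X i)`, then `X i` does not divide `φ`, as
annihilators are saturated. -/
lemma not_X_dvd_of_Ann_eq {c : Config 2} {φ : MvPolynomial (Fin 2) ℂ}
    {J : Ideal (MvPolynomial (Fin 2) ℂ)} (hφ0 : φ ≠ 0) (h : Ann c = Ideal.span {φ} * J)
    {i : Fin 2} (hJ : ∃ f ∈ J, ¬ X i ∣ f) : ¬ X i ∣ φ := by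
  rintro ⟨ψ, rfl⟩
  obtain ⟨f, hf, hXf⟩ := hJ
  have h1 : X i * ψ * f ∈ Ann c := by
    rw [h]
    exact Ideal.mul_mem_mul (Ideal.mem_span_singleton_self _) hf
  rw [mul_assoc, X_mul_mem_Ann, h, Ideal.mem_span_singleton_mul] at h1
  obtain ⟨z, -, hz⟩ := h1
  refine hXf ⟨z, mul_left_cancel₀ (right_ne_zero_of_mul hφ0) ?_⟩
  rw [← hz]
  ring

end Elimination

/-! ### Zero-dimensional annihilators -/

section Periodic

/-- A bi-infinite sequence with values in a finite set that satisfies a linear recurrence is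
periodic, with a period depending only on the recurrence and on the set. -/
lemma exists_period_of_recurrence {A : Set ℂ} (hA : A.Finite) {p : Polynomial ℂ} (hp : p ≠ 0) :
    ∃ N : ℕ, 0 < N ∧ ∀ a : ℤ → ℂ, (∀ t, a t ∈ A) →
      (∀ t : ℤ, ∑ k ∈ Finset.range (p.natDegree + 1), p.coeff k * a (t + k) = 0) →
      ∀ t, a (t + N) = a t := by
  classical
  have := hA.fintype
  set n := p.natDegree with hn
  set K := Fintype.card (Fin n → A) with hK
  refine ⟨K.factorial, K.factorial_pos, fun a ha hrec t => ?_⟩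
  -- two windows of length `n` to the left of `t` agree
  let W : Fin (K + 1) → (Fin n → A) := fun j k => ⟨a (t - K + j + k), ha _⟩
  obtain ⟨j₁, j₂, hne, hW⟩ := Fintype.exists_ne_map_eq_of_card_lt W (by simp [hK])
  wlog hlt : j₁ < j₂ generalizing j₁ j₂
  · exact this j₂ j₁ hne.symm hW.symm (lt_of_le_of_ne (not_lt.1 hlt) hne.symm)
  set q : ℕ := j₂ - j₁ with hq
  have hqpos : 0 < q := Nat.sub_pos_of_lt hlt
  have hqle : q ≤ K := by omega
  have hper : ∀ m : ℕ, a (t - K + j₁ + m + q) = a (t - K + j₁ + m) := by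
    intro m
    induction m using Nat.strong_induction_on with
    | _ m ih =>
      by_cases hm : m < n
      · have := congrArg Subtype.val (congrFun hW ⟨m, hm⟩)
        simp only [W] at this
        rw [this]
        congr 1
        rw [hq, Nat.cast_sub hlt.le]
        ring
      · obtain ⟨r, rfl⟩ := Nat.exists_eq_add_of_le (not_lt.1 hm)
        have e1 := hrec (t - K + j₁ + r)
        have e2 := hrec (t - K + j₁ + r + q)
        rw [Finset.sum_range_succ] at e1 e2
        have e3 : ∀ k ∈ Finset.range n, p.coeff k * a (t - K + j₁ + r + q + k) =
            p.coeff k * a (t - K + j₁ + r + k) := fun k hk => by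
          have := ih (r + k) (by have := Finset.mem_range.1 hk; omega)
          push_cast at this
          rw [← add_assoc] at this
          rw [← this]
          congr 2
          ring
        rw [Finset.sum_congr rfl e3] at e2
        have hlead : p.coeff n ≠ 0 := Polynomial.leadingCoeff_ne_zero.2 hp
        have e4 := mul_left_cancel₀ hlead (add_left_cancel (e2.trans e1.symm))
        push_cast
        convert e4 using 2 <;> ring
  have hper' : ∀ l : ℕ, a (t + l * q) = a t := by
    intro l
    induction l with
    | zero => simp
    | succ l ih =>
      have := hper (K - j₁ + l * q)
      rw [← ih]
      convert this using 2 <;> push_cast [Nat.cast_sub (by omega : (j₁ : ℕ) ≤ K)] <;> ring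
  obtain ⟨l, hl⟩ := Nat.dvd_factorial hqpos hqle
  rw [hl, mul_comm]
  exact_mod_cast hper' l

lemma exists_period_of_aeval_mem {c : Config 2} (hc : IsFinitary c) {p : Polynomial ℂ} (hp : p ≠ 0)
    {i : Fin 2} (h : Polynomial.aeval (MvPolynomial.X i) p ∈ Ann c) :
    ∃ N : ℕ, 0 < N ∧ HasPeriod c (Pi.single i (N : ℤ)) := by
  obtain ⟨N, hN, hper⟩ := exists_period_of_recurrence hc hp
  refine ⟨N, hN, fun v => ?_⟩
  have hrec := hper (fun t => c (v - t • Pi.single i 1)) (fun t => ⟨_, rfl⟩) (fun t => ?_) (-N)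
  · simp only [neg_add_cancel, zero_smul, sub_zero, neg_smul, sub_neg_eq_add] at hrec
    rw [hrec]
    congr 2
    rw [← Pi.single_smul, smul_eq_mul, mul_one]
  · have hX : ∀ k : ℕ, toLaurent 2 (MvPolynomial.X i ^ k) =
        AddMonoidAlgebra.single (k • Pi.single i (1 : ℤ)) 1 := fun k => by
      rw [MvPolynomial.X, MvPolynomial.monomial_pow, one_pow, toLaurent_monomial]
      congr 1
      ext j
      by_cases hj : j = i
      · subst hj; simp [expCast]
      · simp [expCast, hj]
    have h0 := congrFun (mem_Ann _ |>.1 h) (v - t • Pi.single i 1)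
    rw [Polynomial.aeval_eq_sum_range, map_sum, act_sum_left, Finset.sum_apply, Pi.zero_apply] at h0
    rw [← h0]
    refine Finset.sum_congr rfl fun k _ => ?_
    rw [← MvPolynomial.C_mul', map_mul, act_mul, MvPolynomial.C_apply, toLaurent_monomial,
      act_single, hX, act_single, map_zero, sub_zero, one_mul, add_smul, natCast_zsmul, sub_sub]

/-- An ideal containing, for each variable, a separable polynomial in it, is an intersection of
finitely many maximal ideals. With `E z` the products of Lagrange basis polynomials, `f E_z` and
`f(z) E_z` agree modulo the ideal, and the `E z` add up to `1`. -/
lemma exists_eq_inf_of_nodal_mem {σ : Type*} [Fintype σ] {J : Ideal (MvPolynomial σ ℂ)}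
    (s : σ → Finset ℂ) (hs : ∀ i, (s i).Nonempty)
    (h : ∀ i, Polynomial.aeval (MvPolynomial.X i : MvPolynomial σ ℂ)
      (Lagrange.nodal (s i) id) ∈ J) :
    ∃ S : Finset (Ideal (MvPolynomial σ ℂ)), (∀ M ∈ S, M.IsMaximal) ∧ J = S.inf id := by
  classical
  let E : (σ → ℂ) → MvPolynomial σ ℂ := fun z =>
    ∏ i, Polynomial.aeval (MvPolynomial.X i) (Lagrange.basis (s i) id (z i))
  have hsum : ∑ z ∈ Fintype.piFinset s, E z = 1 := by
    rw [← Finset.prod_univ_sum s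
      (fun i a => Polynomial.aeval (MvPolynomial.X i) (Lagrange.basis (s i) id a))]
    refine Finset.prod_eq_one fun i _ => ?_
    rw [← map_sum, Lagrange.sum_basis Function.injective_id.injOn (hs i), map_one]
  have hX : ∀ z ∈ Fintype.piFinset s, ∀ i,
      (MvPolynomial.X i - MvPolynomial.C (z i)) * E z ∈ J := fun z hz i => by
    have hdvd : Lagrange.nodal (s i) id ∣
        (Polynomial.X - Polynomial.C (z i)) * Lagrange.basis (s i) id (z i) := by
      rw [Lagrange.nodal_eq_mul_nodal_erase (Fintype.mem_piFinset.1 hz i)]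
      refine mul_dvd_mul_left _ (Finset.prod_dvd_prod_of_dvd _ _ fun j _ => ?_)
      exact Dvd.intro_left _ rfl
    refine Ideal.mem_of_dvd _ ((map_dvd (Polynomial.aeval (MvPolynomial.X i)) hdvd).trans ?_) (h i)
    rw [map_mul, map_sub, Polynomial.aeval_X, Polynomial.aeval_C]
    exact mul_dvd_mul_left _ (Finset.dvd_prod_of_mem
      (fun i => Polynomial.aeval (MvPolynomial.X i) (Lagrange.basis (s i) id (z i)))
      (Finset.mem_univ i))
  have hE : ∀ z ∈ Fintype.piFinset s, ∀ f : MvPolynomial σ ℂ,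
      f * E z - MvPolynomial.C (MvPolynomial.eval z f) * E z ∈ J := fun z hz f => by
    induction f using MvPolynomial.induction_on with
    | C a => simp
    | add p q hp hq =>
      convert J.add_mem hp hq using 1
      rw [map_add, map_add]
      ring
    | mul_X p i hp =>
      convert J.add_mem (J.mul_mem_left (MvPolynomial.X i) hp)
        (J.mul_mem_left (MvPolynomial.C (MvPolynomial.eval z p)) (hX z hz i)) using 1
      rw [map_mul, MvPolynomial.eval_X, map_mul]
      ring
  refine ⟨((Fintype.piFinset s).filter fun z => ∀ f ∈ J, MvPolynomial.eval z f = 0).image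
    fun z => MvPolynomial.vanishingIdeal ℂ {z}, fun M hM => ?_, le_antisymm ?_ fun f hf => ?_⟩
  · obtain ⟨z, -, rfl⟩ := Finset.mem_image.1 hM
    exact MvPolynomial.isMaximal_iff_eq_vanishingIdeal_singleton.2 ⟨z, rfl⟩
  · refine Finset.le_inf fun M hM => ?_
    obtain ⟨z, hz, rfl⟩ := Finset.mem_image.1 hM
    intro f hf
    rw [id, MvPolynomial.mem_vanishingIdeal_singleton_iff, MvPolynomial.aeval_eq_eval]
    exact (Finset.mem_filter.1 hz).2 f hf
  · rw [← mul_one f, ← hsum, Finset.mul_sum]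
    refine J.sum_mem fun z hz => ?_
    by_cases hzJ : ∀ g ∈ J, MvPolynomial.eval z g = 0
    · have hfz : MvPolynomial.eval z f = 0 := by
        have := Finset.inf_le (f := id) (Finset.mem_image_of_mem
          (fun z => MvPolynomial.vanishingIdeal ℂ {z}) (Finset.mem_filter.2 ⟨hz, hzJ⟩)) hf
        rwa [id, MvPolynomial.mem_vanishingIdeal_singleton_iff, MvPolynomial.aeval_eq_eval] at this
      simpa [hfz] using hE z hz f
    · push Not at hzJ
      obtain ⟨g, hg, hgz⟩ := hzJ
      have h1 := J.sub_mem (J.mul_mem_right (E z) hg) (hE z hz g)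
      rw [sub_sub_cancel] at h1
      refine J.mul_mem_left f ?_
      convert J.mul_mem_left (MvPolynomial.C (MvPolynomial.eval z g)⁻¹) h1 using 1
      rw [← mul_assoc, ← map_mul, inv_mul_cancel₀ hgz, map_one, one_mul]

lemma nodal_nthRootsFinset {N : ℕ} (hN : 0 < N) :
    Lagrange.nodal (Polynomial.nthRootsFinset N (1 : ℂ)) id = Polynomial.X ^ N - 1 := by
  rw [Polynomial.X_pow_sub_one_eq_prod hN (Complex.isPrimitiveRoot_exp N hN.ne'),
    Lagrange.nodal_eq]
  rfl

lemma exists_Ann_eq_inf_of_hasPeriod {c : Config 2}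
    (h : ∀ i, ∃ N : ℕ, 0 < N ∧ HasPeriod c (Pi.single i (N : ℤ))) :
    ∃ S : Finset (Ideal (MvPolynomial (Fin 2) ℂ)), (∀ M ∈ S, M.IsMaximal) ∧ Ann c = S.inf id := by
  choose N hN hper using h
  refine exists_eq_inf_of_nodal_mem (fun i => Polynomial.nthRootsFinset (N i) (1 : ℂ))
    (fun i => ⟨1, (Polynomial.mem_nthRootsFinset (hN i) _).2 (one_pow _)⟩) fun i => ?_
  have := polyBinom_mem_Ann.2 (hper i)
  rw [nodal_nthRootsFinset (hN i), map_sub, map_pow, Polynomial.aeval_X, map_one]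
  convert this using 1
  rw [polyBinom, MvPolynomial.X_pow_eq_monomial]
  congr 1
  · congr 2
    ext j
    by_cases hj : j = i
    · subst hj; simp
    · simp [hj]
  · rw [MvPolynomial.one_def]
    congr 2
    ext j
    by_cases hj : j = i
    · subst hj; simp
    · simp [hj]

lemma isDoublyPeriodic_of_hasPeriod {c : Config 2}
    (h : ∀ i, ∃ N : ℕ, 0 < N ∧ HasPeriod c (Pi.single i (N : ℤ))) : IsDoublyPeriodic c := by
  obtain ⟨M, hM, h0⟩ := h 0
  obtain ⟨N, hN, h1⟩ := h 1
  refine ⟨_, _, ?_, h0, h1⟩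
  rw [LinearIndependent.pair_iff]
  intro s t hst
  have e0 := congrFun hst 0
  have e1 := congrFun hst 1
  simp at e0 e1
  omega

lemma det_ne_zero_of_linearIndependent {u w : Fin 2 → ℤ} (h : LinearIndependent ℤ ![u, w]) :
    det u w ≠ 0 := by
  intro h0
  obtain ⟨t, k, l, ht, hk, hl⟩ :=
    exists_common_multiple_of_det_eq_zero (h.ne_zero 0) (h.ne_zero 1) h0
  have := (LinearIndependent.pair_iff.1 h k (-l) (by
    rw [neg_smul, ← sub_eq_add_neg, sub_eq_zero]; exact hk.symm.trans hl)).1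
  exact ht (by rw [hk, this, zero_smul])

end Periodic

/-! ### Existence of the factorization of the annihilator -/

section Existence

open MvPolynomial

lemma not_X_dvd_of_dvd {φ : MvPolynomial (Fin 2) ℂ} {i : Fin 2} {ψ : MvPolynomial (Fin 2) ℂ}
    (h : ¬ X i ∣ φ) (hd : ψ ∣ φ) : ¬ X i ∣ ψ := fun h' => h (h'.trans hd)

/-- A divisor of a product of binomials in pairwise distinct directions is, if no variable divides
it, up to a unit a product of line polynomials in distinct directions. -/
lemma exists_list_isLine {L : List (Fin 2 → ℤ)} (h0 : ∀ u ∈ L, u ≠ 0)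
    (hL : L.Pairwise (fun u w => det u w ≠ 0)) {φ : MvPolynomial (Fin 2) ℂ}
    (hdvd : φ ∣ (L.map polyBinom).prod) (hX : ∀ i, ¬ X i ∣ φ) :
    ∃ Ψ : List (MvPolynomial (Fin 2) ℂ), Associated Ψ.prod φ ∧
      (∀ ψ ∈ Ψ, IsLine (toLaurent 2 ψ) ∧ ∃ u ∈ L, IsAlong u ψ) ∧
      Ψ.Pairwise fun ψ χ => direction (toLaurent 2 ψ) ≠ direction (toLaurent 2 χ) := by
  induction L generalizing φ with
  | nil =>
    exact ⟨[], by simpa using (associated_one_iff_isUnit.2 (isUnit_of_dvd_one hdvd)).symm,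
      by simp, List.Pairwise.nil⟩
  | cons u L ih =>
    rw [List.map_cons, List.prod_cons] at hdvd
    rw [List.pairwise_cons] at hL
    obtain ⟨a, b, ha, hb, rfl⟩ := exists_dvd_and_dvd_of_dvd_mul hdvd
    have hu : u ≠ 0 := h0 u (by simp)
    obtain ⟨Ψ, hΨ, hline, hpair⟩ := ih (fun x hx => h0 x (by simp [hx])) hL.2 hb
      (fun i => not_X_dvd_of_dvd (hX i) (Dvd.intro_left a rfl))
    have hline' : ∀ ψ ∈ Ψ, IsLine (toLaurent 2 ψ) ∧ ∃ w ∈ u :: L, IsAlong w ψ := fun ψ hψ =>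
      ⟨(hline ψ hψ).1, by
        obtain ⟨w, hw, h⟩ := (hline ψ hψ).2
        exact ⟨w, by simp [hw], h⟩⟩
    by_cases hunit : IsUnit a
    · exact ⟨Ψ, hΨ.trans (associated_unit_mul_right b a hunit), hline', hpair⟩
    have ha0 : a ≠ 0 := ne_zero_of_dvd_ne_zero (polyBinom_ne_zero hu) ha
    have halong : IsAlong u a := (isAlong_polyBinom u).of_dvd (polyBinom_ne_zero hu) ha
    have haline : IsLine (toLaurent 2 a) := by
      refine halong.isLine hu (Set.not_subsingleton_iff.1 fun hs => hunit ?_)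
      exact isUnit_of_subsingleton_support ha0
        (fun i => not_X_dvd_of_dvd (hX i) (Dvd.intro b rfl)) hs
    refine ⟨a :: Ψ, ?_, ?_, ?_⟩
    · rw [List.prod_cons]
      exact hΨ.mul_left a
    · intro ψ hψ
      rcases List.mem_cons.1 hψ with rfl | hψ
      · exact ⟨haline, u, by simp, halong⟩
      · exact hline' ψ hψ
    · rw [List.pairwise_cons]
      refine ⟨fun ψ hψ hdir => ?_, hpair⟩
      obtain ⟨hψline, w, hw, hψ⟩ := hline ψ hψ
      rw [haline.direction_eq hu halong, hψline.direction_eq (h0 w (by simp [hw])) hψ] at hdir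
      refine hL.1 w hw ((toRat_mem_span_iff hu).1 ?_)
      rw [hdir]
      exact Submodule.mem_span_singleton_self _

lemma exists_isAnnDecomposition {c : Config 2} (hfin : IsFinitary c) {L : List (Fin 2 → ℤ)}
    (h0 : ∀ u ∈ L, u ≠ 0) (hL : L.Pairwise (fun u w => det u w ≠ 0))
    (hLc : (L.map polyBinom).prod ∈ Ann c) :
    ∃ (m : ℕ) (φ : Fin m → MvPolynomial (Fin 2) ℂ) (H : Ideal (MvPolynomial (Fin 2) ℂ)),
      IsAnnDecomposition c m φ H := by
  have hprod0 : (L.map polyBinom).prod ≠ 0 := by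
    rw [Ne, List.prod_eq_zero_iff, List.mem_map]
    rintro ⟨u, hu, h⟩
    exact polyBinom_ne_zero (h0 u hu) h
  have hAnn0 : Ann c ≠ ⊥ := fun h => hprod0 (by rwa [h, Ideal.mem_bot] at hLc)
  obtain ⟨φ, J, hφ0, hφJ, hJ⟩ := exists_eq_span_mul (Ann c) hAnn0
  have hJ0 : J ≠ ⊥ := by
    rintro rfl
    exact hAnn0 (by rw [hφJ, Ideal.mul_bot])
  have helim := exists_aeval_X_mem hJ0 hJ
  -- `J` is the annihilator of the finitary configuration `φ c`
  have hJAnn : Ann (act (toLaurent 2 φ) c) = J := by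
    ext f
    rw [mem_Ann_act, hφJ, Ideal.mem_span_singleton_mul]
    constructor
    · rintro ⟨z, hz, h⟩
      rw [mul_comm f, mul_right_inj' hφ0] at h
      exact h ▸ hz
    · exact fun hf => ⟨f, hf, mul_comm _ _⟩
  obtain ⟨S, hS, hSJ⟩ := exists_Ann_eq_inf_of_hasPeriod (c := act (toLaurent 2 φ) c) fun i => by
    obtain ⟨p, hp0, hp⟩ := helim i
    exact exists_period_of_aeval_mem (hfin.act _) hp0 (hJAnn ▸ hp)
  have hX : ∀ i, ¬ X i ∣ φ := fun i =>
    not_X_dvd_of_Ann_eq hφ0 hφJ (exists_mem_not_X_dvd helim i)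
  have hdvd : φ ∣ (L.map polyBinom).prod := by
    rw [hφJ, Ideal.mem_span_singleton_mul] at hLc
    obtain ⟨z, -, hz⟩ := hLc
    exact Dvd.intro z hz
  obtain ⟨Ψ, hΨ, hline, hpair⟩ := exists_list_isLine h0 hL hdvd hX
  refine ⟨Ψ.length, Ψ.get, J, ⟨fun i => (hline _ (Ψ.get_mem i)).1, fun i j hij => ?_,
    ⟨S, hS, hJAnn ▸ hSJ⟩, ?_⟩⟩
  · rw [List.pairwise_iff_get] at hpair
    rcases lt_or_gt_of_ne hij with h | h
    · exact hpair i j h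
    · exact (hpair j i h).symm
  · rw [hφJ, Ideal.span_singleton_eq_span_singleton.2 hΨ.symm, ← List.prod_ofFn, List.ofFn_get]

end Existence

/-! ### Coprimality of the two factors of the annihilator -/

section Coprime

open MvPolynomial

/-- By the Nullstellensatz, a finite intersection of maximal ideals contains a product of factors
`X i - z i` over the corresponding points `z`. -/
lemma exists_aeval_X_mem_inf {S : Finset (Ideal (MvPolynomial (Fin 2) ℂ))}
    (hS : ∀ M ∈ S, M.IsMaximal) (i : Fin 2) :
    ∃ p : Polynomial ℂ, p ≠ 0 ∧
      Polynomial.aeval (X i : MvPolynomial (Fin 2) ℂ) p ∈ S.inf id := by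
  have hz : ∀ M : Ideal (MvPolynomial (Fin 2) ℂ), ∃ z : Fin 2 → ℂ, M ∈ S →
      M = vanishingIdeal ℂ {z} := fun M => by
    by_cases hM : M ∈ S
    · obtain ⟨z, hz⟩ := isMaximal_iff_eq_vanishingIdeal_singleton.1 (hS M hM)
      exact ⟨z, fun _ => hz⟩
    · exact ⟨0, fun h => absurd h hM⟩
  choose z hz using hz
  refine ⟨∏ M ∈ S, (Polynomial.X - Polynomial.C (z M i)),
    Finset.prod_ne_zero_iff.2 fun M _ => Polynomial.X_sub_C_ne_zero _, ?_⟩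
  rw [Submodule.mem_finsetInf]
  intro M hM
  rw [map_prod]
  refine Ideal.mem_of_dvd _ (Finset.dvd_prod_of_mem _ hM) ?_
  refine (SetLike.ext_iff.1 (hz M hM) _).2 ?_
  rw [mem_vanishingIdeal_singleton_iff]
  simp

lemma eq_zero_of_monomial_mem_Ann {d : ℕ} {c : Config d} {s : Fin d →₀ ℕ}
    (h : monomial s 1 ∈ Ann c) : c = 0 := by
  rw [mem_Ann, ← mul_one (toLaurent d _),
    act_isUnit_mul _ (isUnit_toLaurent_monomial s one_ne_zero), act_one] at h
  exact h

/-- The binomials `X^u - 1` are smooth at every point of the torus: if one factors as a product of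
two elements of an ideal, the ideal contains a monomial. -/
lemma exists_monomial_mem_of_polyBinom_eq_mul {u : Fin 2 → ℤ} (hu : u ≠ 0)
    {M : Ideal (MvPolynomial (Fin 2) ℂ)} {f q : MvPolynomial (Fin 2) ℂ} (hf : f ∈ M) (hq : q ∈ M)
    (h : polyBinom u = f * q) : ∃ s, monomial s 1 ∈ M := by
  obtain ⟨i, hi⟩ := Function.ne_iff.1 hu
  set s : Fin 2 →₀ ℕ := Finsupp.equivFunOnFinite.symm fun i => (u i).toNat with hs
  set t : Fin 2 →₀ ℕ := Finsupp.equivFunOnFinite.symm fun i => (-u i).toNat with ht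
  have h1 : X i * pderiv i (polyBinom u) ∈ M := by
    rw [h, pderiv_mul]
    exact M.mul_mem_left _ (M.add_mem (M.mul_mem_left _ hq) (M.mul_mem_right _ hf))
  have h2 : polyBinom u ∈ M := h ▸ M.mul_mem_right _ hf
  have h3 : X i * pderiv i (polyBinom u) - C (t i : ℂ) * polyBinom u =
      C (u i : ℂ) * monomial s 1 := by
    rw [polyBinom, map_sub, mul_sub, X_mul_pderiv_monomial, X_mul_pderiv_monomial, ← hs, ← ht,
      nsmul_eq_mul, nsmul_eq_mul, ← map_natCast C, ← map_natCast C]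
    have : (u i : ℂ) = (s i : ℂ) - (t i : ℂ) := by
      have : u i = (s i : ℤ) - (t i : ℤ) := by
        simp [hs, ht]
      rw [this]
      push_cast
      rfl
    rw [this, map_sub]
    ring
  refine ⟨s, ?_⟩
  have h4 := M.mul_mem_left (C (u i : ℂ)⁻¹) (h3 ▸ M.sub_mem h1 (M.mul_mem_left _ h2))
  rwa [← mul_assoc, ← map_mul, inv_mul_cancel₀ (by exact_mod_cast hi), map_one, one_mul] at h4

lemma polyBinom_mem_Ann_of_sq {u : Fin 2 → ℤ} {b : Config 2} (hb : IsFinitary b)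
    (h : polyBinom u * polyBinom u ∈ Ann b) : polyBinom u ∈ Ann b := by
  obtain ⟨B, hB⟩ := hb.exists_bound
  obtain ⟨w, hw, h'⟩ := toLaurent_polyBinom u
  rw [mem_Ann, map_mul, h', mul_mul_mul_comm, act_isUnit_mul _ (hw.mul hw), act_mul] at h
  rw [mem_Ann, h', act_isUnit_mul _ hw]
  exact act_binom_eq_zero_of_sq hB h

/-- In a decomposition `Ann c = φ H` no point of the zero set of `H` lies on `φ`. Otherwise a
suitable multiple `b` of `c` satisfies `Ann (f b) = M` for a line factor `f ∈ M` of `φ`, and the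
multiple `X^u - 1` of `f` satisfies `(X^u - 1)² b = 0`. By boundedness `(X^u - 1) b = 0`, so the
cofactor of `f` in `X^u - 1` also lies in `M`, and `X^u - 1` would be singular at that point. -/
lemma notMem_of_Ann_eq {c : Config 2} (hfin : IsFinitary c) {f g : MvPolynomial (Fin 2) ℂ}
    {S : Finset (Ideal (MvPolynomial (Fin 2) ℂ))} (hS : ∀ M ∈ S, M.IsMaximal)
    (hAnn : Ann c = Ideal.span {f * g} * S.inf id) (hfg : f * g ≠ 0) {u : Fin 2 → ℤ} (hu : u ≠ 0)
    (hdvd : f ∣ polyBinom u) {M : Ideal (MvPolynomial (Fin 2) ℂ)} (hM : M ∈ S) : f ∉ M := by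
  classical
  intro hfM
  have hMmax := hS M hM
  have hMprime := hMmax.isPrime
  -- multiplication by `h` removes all maximal ideals other than `M`
  obtain ⟨h, hh, hhM⟩ : ∃ h ∈ (S.erase M).inf id, h ∉ M := by
    by_contra! hle
    obtain ⟨M', hM', hle⟩ := (Ideal.IsPrime.inf_le' hMprime).1 hle
    rw [Finset.mem_erase] at hM'
    exact hM'.1 ((hS M' hM'.2).eq_of_le hMmax.ne_top hle)
  set b := act (toLaurent 2 (g * h)) c with hb
  set d := act (toLaurent 2 f) b with hd
  have hAnnd : Ann d = M := by
    ext k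
    rw [hd, mem_Ann_act, hb, mem_Ann_act, hAnn, Ideal.mem_span_singleton_mul]
    have key : k * h ∈ S.inf id ↔ k ∈ M := by
      rw [← Finset.insert_erase hM, Finset.inf_insert, id, Submodule.mem_inf]
      exact ⟨fun hk => (hMprime.mem_or_mem hk.1).resolve_right hhM,
        fun hk => ⟨M.mul_mem_right _ hk, Ideal.mul_mem_left _ _ hh⟩⟩
    rw [← key]
    constructor
    · rintro ⟨z, hz, he⟩
      have : z = k * h := mul_left_cancel₀ hfg (he.trans (by ring))
      exact this ▸ hz
    · exact fun hk => ⟨_, hk, by ring⟩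
  obtain ⟨q, hq⟩ := hdvd
  have h1 : polyBinom u ∈ Ann b := by
    refine polyBinom_mem_Ann_of_sq (hfin.act _) ?_
    have : q * polyBinom u ∈ Ann d := by
      rw [hAnnd, hq]
      exact M.mul_mem_left _ (M.mul_mem_right _ hfM)
    rw [hd, mem_Ann_act] at this
    convert this using 1
    conv_lhs => rw [hq]
    rw [hq]
    ring
  have hqM : q ∈ M := by
    rw [← hAnnd, hd, mem_Ann_act, mul_comm, ← hq]
    exact h1
  obtain ⟨s, hs⟩ := exists_monomial_mem_of_polyBinom_eq_mul hu hfM hqM hq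
  rw [← hAnnd] at hs hMmax
  exact Ann_ne_top_iff d |>.1 hMmax.ne_top (eq_zero_of_monomial_mem_Ann hs)

end Coprime

/-! ### Splitting a configuration along a factorization -/

section Splitting

open MvPolynomial

/-- The configuration whose coefficients are the values of a linear functional on monomials. -/
noncomputable def ofFunctional {d : ℕ} (l : Laurent d →ₗ[ℂ] ℂ) : Config d :=
  fun v => l (AddMonoidAlgebra.single (-v) 1)

lemma act_ofFunctional {d : ℕ} (l : Laurent d →ₗ[ℂ] ℂ) (f : Laurent d) (v : Fin d → ℤ) :
    act f (ofFunctional l) v = l (f * AddMonoidAlgebra.single (-v) 1) := by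
  induction f using AddMonoidAlgebra.induction_linear with
  | zero => simp
  | add f g hf hg => rw [act_add_left, Pi.add_apply, hf, hg, add_mul, map_add]
  | single u a =>
    rw [act_single, ofFunctional, AddMonoidAlgebra.single_mul_single, ← smul_eq_mul, ← map_smul,
      neg_sub, ← sub_eq_add_neg, AddMonoidAlgebra.smul_single, smul_eq_mul]

lemma isRelPrime_monomial {σ : Type*} [Fintype σ] {f : MvPolynomial σ ℂ} (hX : ∀ i, ¬ X i ∣ f)
    (s : σ →₀ ℕ) : IsRelPrime f (monomial s 1) := by
  rw [monomial_eq, map_one, one_mul, Finsupp.prod]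
  refine IsRelPrime.prod_right fun i _ => IsRelPrime.pow_right ?_
  exact ((X_prime (i := i)).irreducible.isRelPrime_iff_not_dvd.2 (hX i)).symm

/-- Relatively prime polynomials without monomial factors divide a Laurent polynomial jointly. -/
lemma toLaurent_prod_dvd {d : ℕ} {ι : Type*} [Fintype ι] {φ : ι → MvPolynomial (Fin d) ℂ}
    (hX : ∀ j i, ¬ X i ∣ φ j) (hrel : Pairwise (Function.onFun IsRelPrime φ)) {f : Laurent d}
    (h : ∀ j, toLaurent d (φ j) ∣ f) : toLaurent d (∏ j, φ j) ∣ f := by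
  obtain ⟨s, p, hp⟩ := exists_toLaurent_eq_mul f
  have hdvd : ∀ j, φ j ∣ p := fun j => by
    obtain ⟨q, hq⟩ := h j
    obtain ⟨t, r, hr⟩ := exists_toLaurent_eq_mul q
    refine (isRelPrime_monomial (hX j) t).dvd_of_dvd_mul_right ⟨r * monomial s 1, ?_⟩
    apply toLaurent_injective
    simp only [map_mul, hp, hr, hq]
    ring
  have := map_dvd (toLaurent d) (Fintype.prod_dvd_of_isRelPrime hrel hdvd)
  rw [hp] at this
  exact ((isUnit_toLaurent_monomial s one_ne_zero).dvd_mul_right).1 this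

/-- A configuration annihilated by a product of relatively prime polynomials `φ j` is a sum of
configurations annihilated by the factors: a functional on `R ⧸ (∏ φ j)` extends along the
embedding into the product of the `R ⧸ (φ j)`, where `R` is the Laurent polynomial ring. -/
lemma exists_eq_sum_of_prod_mem_Ann {d : ℕ} {ι : Type*} [Fintype ι]
    {φ : ι → MvPolynomial (Fin d) ℂ} (hX : ∀ j i, ¬ X i ∣ φ j)
    (hrel : Pairwise (Function.onFun IsRelPrime φ)) {b : Config d} (hb : ∏ j, φ j ∈ Ann b) :
    ∃ ci : ι → Config d, b = ∑ j, ci j ∧ ∀ j, φ j ∈ Ann (ci j) := by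
  classical
  let l : Laurent d →ₗ[ℂ] ℂ :=
    { toFun := fun f => act f b 0
      map_add' := fun f g => by rw [act_add_left]; rfl
      map_smul' := fun a f => by rw [act_smul_left]; rfl }
  let mk : ∀ j, Laurent d →ₗ[ℂ] (Laurent d ⧸ Ideal.span {toLaurent d (φ j)}) := fun j =>
    (Ideal.Quotient.mkₐ ℂ (Ideal.span {toLaurent d (φ j)})).toLinearMap
  have hmk : ∀ j f, mk j f = 0 ↔ toLaurent d (φ j) ∣ f := fun j f => by
    rw [← Ideal.mem_span_singleton]
    exact Ideal.Quotient.eq_zero_iff_mem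
  obtain ⟨μ, hμ⟩ : l ∈ LinearMap.range (LinearMap.pi mk).dualMap := by
    rw [LinearMap.range_dualMap_eq_dualAnnihilator_ker, Submodule.mem_dualAnnihilator]
    intro f hf
    have hf' : ∀ j, toLaurent d (φ j) ∣ f := fun j => (hmk j f).1 (congrFun hf j)
    exact congrFun (act_eq_zero_of_dvd (toLaurent_prod_dvd hX hrel hf') hb) 0
  let lj : ι → Laurent d →ₗ[ℂ] ℂ := fun j => μ ∘ₗ LinearMap.single ℂ _ j ∘ₗ mk j
  refine ⟨fun j => ofFunctional (lj j), ?_, fun j => ?_⟩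
  · funext v
    rw [Finset.sum_apply]
    have h1 : b v = l (AddMonoidAlgebra.single (-v) 1) := by
      change _ = act _ b 0
      rw [act_single, one_mul, zero_sub, neg_neg]
    rw [h1, ← hμ, LinearMap.dualMap_apply]
    simp only [ofFunctional, lj, LinearMap.comp_apply]
    rw [← map_sum]
    congr 1
    exact (LinearMap.sum_single_apply _ _).symm
  · rw [mem_Ann]
    funext v
    rw [act_ofFunctional]
    simp only [lj, LinearMap.comp_apply]
    rw [(hmk j _).2 (dvd_mul_right _ _), map_zero, map_zero]
    rfl

end Splitting

/-! ### The strong decomposition -/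

section Decomposition

open MvPolynomial

/-- If `Ann c = φ H` with `a φ + e = 1` and `e ∈ H`, then `e c` and `a φ c` are the components of
`c` with annihilators `(φ)` and `H`, by the Chinese remainder theorem. -/
lemma Ann_components {d : ℕ} {c : Config d} {φ a e : MvPolynomial (Fin d) ℂ}
    {H : Ideal (MvPolynomial (Fin d) ℂ)} (hφ : φ ≠ 0) (hAnn : Ann c = Ideal.span {φ} * H)
    (he : e ∈ H) (h1 : a * φ + e = 1) :
    c = act (toLaurent d e) c + act (toLaurent d (a * φ)) c ∧
    Ann (act (toLaurent d e) c) = Ideal.span {φ} ∧ Ann (act (toLaurent d (a * φ)) c) = H ∧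
    ∀ x y : Config d, c = x + y → Ann x = Ideal.span {φ} → Ann y = H →
      x = act (toLaurent d e) c ∧ y = act (toLaurent d (a * φ)) c := by
  have hc : c = act (toLaurent d e) c + act (toLaurent d (a * φ)) c := by
    rw [← act_add_left, ← map_add, add_comm, h1, map_one, act_one]
  refine ⟨hc, ?_, ?_, fun x y hxy hx hy => ?_⟩
  · ext f
    rw [mem_Ann_act, hAnn, Ideal.mem_span_singleton_mul, Ideal.mem_span_singleton]
    constructor
    · rintro ⟨z, -, hz⟩
      exact ⟨f * a + z, by linear_combination -(f * h1) - hz⟩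
    · rintro ⟨k, rfl⟩
      exact ⟨k * e, H.mul_mem_left _ he, by ring⟩
  · ext f
    rw [mem_Ann_act, hAnn, Ideal.mem_span_singleton_mul]
    constructor
    · rintro ⟨z, hz, h⟩
      have hza : z = f * a := mul_left_cancel₀ hφ (h.trans (by ring))
      have : f = φ * z + f * e := by
        rw [hza]
        linear_combination -(f * h1)
      rw [this]
      exact H.add_mem (H.mul_mem_left _ hz) (H.mul_mem_left _ he)
    · exact fun hf => ⟨f * a, H.mul_mem_right _ hf, by ring⟩
  · have hex : act (toLaurent d e) y = 0 := by
      rw [← mem_Ann, hy]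
      exact he
    have hφx : act (toLaurent d (a * φ)) x = 0 := by
      rw [← mem_Ann, hx]
      exact Ideal.mul_mem_left _ _ (Ideal.mem_span_singleton_self _)
    have hsplit : ∀ b : Config d, b = act (toLaurent d e) b + act (toLaurent d (a * φ)) b :=
      fun b => by rw [← act_add_left, ← map_add, add_comm, h1, map_one, act_one]
    rw [hxy, act_add_right, act_add_right, hex, hφx, add_zero, zero_add]
    constructor
    · have := hsplit x
      rwa [hφx, add_zero] at this
    · have := hsplit y
      rwa [hex, zero_add] at this

/-- The second half of the strong decomposition theorem, with `L` the list of vectors `u` of an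
annihilating product of binomials `X^u - 1`. -/
lemma exists_decomposition {c : Config 2} (hfin : IsFinitary c) {L : List (Fin 2 → ℤ)}
    (h0 : ∀ u ∈ L, u ≠ 0) (hL : L.Pairwise (fun u w => det u w ≠ 0))
    (hLc : (L.map polyBinom).prod ∈ Ann c) {m : ℕ} {φ : Fin m → MvPolynomial (Fin 2) ℂ}
    {H : Ideal (MvPolynomial (Fin 2) ℂ)} (hdec : IsAnnDecomposition c m φ H) :
    ∃ (cφ cH : Config 2) (ci : Fin m → Config 2),
        c = cφ + cH ∧
        cφ = ∑ i, ci i ∧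
        Ann cφ = Ideal.span {∏ i, φ i} ∧
        Ann cH = H ∧
        (∀ i, Ann (ci i) = Ideal.span {φ i}) ∧
        (∀ i, IsOnePeriodicIn (ci i) (direction (toLaurent 2 (φ i)))) ∧
        IsDoublyPeriodic cH ∧
        ∀ a b : Config 2, c = a + b →
          Ann a = Ideal.span {∏ i, φ i} → Ann b = H → a = cφ ∧ b = cH := by
  classical
  obtain ⟨hline, hdir, ⟨S, hS, hHS⟩, hAnn⟩ := hdec
  have hφ0 : ∏ i, φ i ≠ 0 := Finset.prod_ne_zero_iff.2 fun i _ => (hline i).ne_zero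
  have helim : ∀ i, ∃ p : Polynomial ℂ, p ≠ 0 ∧
      Polynomial.aeval (X i : MvPolynomial (Fin 2) ℂ) p ∈ H := fun i =>
    hHS ▸ exists_aeval_X_mem_inf hS i
  have hX : ∀ j i, ¬ X i ∣ φ j := fun j i => not_X_dvd_of_dvd
    (not_X_dvd_of_Ann_eq hφ0 hAnn (exists_mem_not_X_dvd helim i))
    (Finset.dvd_prod_of_mem φ (Finset.mem_univ j))
  choose w hw hwφ hwdir using fun i => (hline i).exists_isAlong
  have hrel : Pairwise (Function.onFun IsRelPrime φ) := fun i j hij => by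
    refine isRelPrime_of_isAlong (fun hdet => hdir i j hij ?_) (hline i).ne_zero (hline j).ne_zero
      (hX i) (hwφ i) (hwφ j)
    rw [hwdir, hwdir]
    exact span_toRat_eq (hw i) (hw j) hdet
  have hunit : ∀ i, ¬ IsUnit (φ i) := fun i hi => by
    obtain ⟨x, hx⟩ := MvPolynomial.isUnit_iff_eq_C_of_isReduced.1 hi
    refine Set.not_subsingleton_iff.2 (hline i).nontrivial_support ?_
    rw [hx.2]
    intro s hs t ht
    rw [Finset.mem_singleton.1 (support_monomial_subset hs),
      Finset.mem_singleton.1 (support_monomial_subset ht)]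
  -- each `φ i` divides a binomial in its own direction
  have hbin : ∀ i, ∃ u ∈ L, det (w i) u = 0 ∧ φ i ∣ polyBinom u := fun i => by
    refine exists_dvd_polyBinom (hw i) (hwφ i) (hline i).ne_zero (hX i) (hunit i) h0 hL ?_
    rw [hAnn, Ideal.mem_span_singleton_mul] at hLc
    obtain ⟨z, -, hz⟩ := hLc
    exact (Finset.dvd_prod_of_mem φ (Finset.mem_univ i)).trans (Dvd.intro z hz)
  choose u huL hdet hdvd using hbin
  have htop : Ideal.span {∏ i, φ i} ⊔ H = ⊤ := by
    rw [hHS, Finset.inf_eq_iInf]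
    refine Ideal.sup_iInf_eq_top fun M hM => ?_
    have hmax := hS M hM
    rw [sup_comm]
    refine hmax.1.2 _ (lt_of_le_of_ne le_sup_left fun heq => ?_)
    have hmem : ∏ i, φ i ∈ M := by
      rw [heq]
      exact Submodule.mem_sup_right (Ideal.mem_span_singleton_self _)
    obtain ⟨i, -, hi⟩ := (hmax.isPrime.prod_mem_iff).1 hmem
    rw [← Finset.mul_prod_erase _ _ (Finset.mem_univ i)] at hφ0 hAnn
    exact notMem_of_Ann_eq hfin hS (hHS ▸ hAnn) hφ0 (h0 _ (huL i)) (hdvd i) hM hi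
  obtain ⟨a, e, he, h1⟩ := Ideal.mem_span_singleton_sup.1 ((Ideal.eq_top_iff_one _).1 htop)
  obtain ⟨hsum, hAnnφ, hAnnH, huniq⟩ := Ann_components hφ0 hAnn he h1
  obtain ⟨ci, hci, hciφ⟩ := exists_eq_sum_of_prod_mem_Ann hX hrel
    (hAnnφ ▸ Ideal.mem_span_singleton_self _ : ∏ i, φ i ∈ Ann (act (toLaurent 2 e) c))
  -- an annihilator of `ci i`, multiplied by the other factors, annihilates `∑ i, ci i`
  have hAnnci : ∀ i, Ann (ci i) = Ideal.span {φ i} := fun i => by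
    refine le_antisymm (fun f hf => ?_) ((Ideal.span_singleton_le_iff_mem _).2 (hciφ i))
    have hmem : f * ∏ j ∈ Finset.univ.erase i, φ j ∈ Ann (act (toLaurent 2 e) c) := by
      rw [mem_Ann, hci, act_sum_right]
      refine Finset.sum_eq_zero fun j _ => ?_
      rw [← mem_Ann]
      by_cases hj : j = i
      · subst hj
        exact Ideal.mul_mem_right _ _ hf
      · exact Ideal.mul_mem_left _ _ (Ideal.mem_of_dvd _
          (Finset.dvd_prod_of_mem φ (Finset.mem_erase.2 ⟨hj, Finset.mem_univ j⟩)) (hciφ j))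
    rw [hAnnφ, Ideal.mem_span_singleton, ← Finset.mul_prod_erase _ _ (Finset.mem_univ i)] at hmem
    rw [Ideal.mem_span_singleton]
    refine (mul_dvd_mul_iff_right (Finset.prod_ne_zero_iff.2 fun j _ => (hline j).ne_zero)).1 hmem
  refine ⟨_, _, ci, hsum, hci, hAnnφ, hAnnH, hAnnci, fun i => ?_, ?_, huniq⟩
  · have hper : HasPeriod (ci i) (u i) := polyBinom_mem_Ann.1 (Ideal.mem_of_dvd _ (hdvd i) (hciφ i))
    refine ⟨⟨⟨u i, h0 _ (huL i), hper⟩, ?_⟩, u i, h0 _ (huL i), ?_, hper⟩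
    · rintro ⟨x, y, hxy, hx, hy⟩
      have hx0 : x ≠ 0 := hxy.ne_zero 0
      have hy0 : y ≠ 0 := hxy.ne_zero 1
      rw [← polyBinom_mem_Ann, hAnnci, Ideal.mem_span_singleton] at hx hy
      exact Set.not_subsingleton_iff.2 (hline i).nontrivial_support
        (IsAlong.subsingleton_support (det_ne_zero_of_linearIndependent hxy)
          ((isAlong_polyBinom x).of_dvd (polyBinom_ne_zero hx0) hx)
          ((isAlong_polyBinom y).of_dvd (polyBinom_ne_zero hy0) hy))
    · rw [hwdir, toRat_mem_span_iff (hw i)]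
      exact hdet i
  · refine isDoublyPeriodic_of_hasPeriod fun i => ?_
    obtain ⟨p, hp0, hp⟩ := helim i
    exact exists_period_of_aeval_mem (hfin.act _) hp0 (hAnnH ▸ hp)

end Decomposition

end MultidimConfig

theorem mainTheorem4 (c : MultidimConfig.Config 2)
    (hfin : MultidimConfig.IsFinitary c) (hint : MultidimConfig.IsIntegral c)
    (hann : ∃ f : MultidimConfig.Laurent 2, f ≠ 0 ∧ MultidimConfig.act f c = 0) :
    (∃ (m : ℕ) (φ : Fin m → MvPolynomial (Fin 2) ℂ) (H : Ideal (MvPolynomial (Fin 2) ℂ)),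
      MultidimConfig.IsAnnDecomposition c m φ H) ∧
    ∀ (m : ℕ) (φ : Fin m → MvPolynomial (Fin 2) ℂ) (H : Ideal (MvPolynomial (Fin 2) ℂ)),
      MultidimConfig.IsAnnDecomposition c m φ H →
      ∃ (cφ cH : MultidimConfig.Config 2) (ci : Fin m → MultidimConfig.Config 2),
        c = cφ + cH ∧
        cφ = ∑ i, ci i ∧
        MultidimConfig.Ann cφ = Ideal.span {∏ i, φ i} ∧
        MultidimConfig.Ann cH = H ∧
        (∀ i, MultidimConfig.Ann (ci i) = Ideal.span {φ i}) ∧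
        (∀ i, MultidimConfig.IsOnePeriodicIn (ci i)
          (MultidimConfig.direction (MultidimConfig.toLaurent 2 (φ i)))) ∧
        MultidimConfig.IsDoublyPeriodic cH ∧
        ∀ a b : MultidimConfig.Config 2, c = a + b →
          MultidimConfig.Ann a = Ideal.span {∏ i, φ i} → MultidimConfig.Ann b = H →
          a = cφ ∧ b = cH := by
  obtain ⟨L₀, hL₀, hL₀c⟩ := MultidimConfig.exists_prod_binom c hfin hint hann
  obtain ⟨L, h0, hL, hLc⟩ :=
    MultidimConfig.exists_pairwise_det_ne_zero hfin _ L₀ rfl hL₀ hL₀c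
  rw [← MultidimConfig.list_prod_polyBinom_mem_Ann] at hLc
  exact ⟨MultidimConfig.exists_isAnnDecomposition hfin h0 hL hLc,
    fun m φ H hdec => MultidimConfig.exists_decomposition hfin h0 hL hLc hdec⟩
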